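/- All graphs are finite, simple and undirected. A graph is outerplanar if it has an embedding in the plane such that all of its vertices lie on the boundary of the outer face. A graph is $F$-free if it has no (not necessarily induced) subgraph isomorphic to $F$. The $Q$-index $q(G)$ of a graph $G$ is the largest eigenvalue of its signless Laplacian matrix $Q(G)=D(G)+A(G)$, where $D(G)$ is the diagonal matrix of the vertex degrees and $A(G)$ is the adjacency matrix. Write $P_\ell$ and $C_\ell$ for the path and the cycle on $\ell$ vertices, and $tP_\ell$ for the disjoint union of $t$ copies of $P_\ell$. Theorem. Let $n\ge 9$, and let $F$ be either $tP_\ell$ with $t\ge 1$, $\ell\ge 2$ and $5\le t\ell\le n-1$, or $C_\ell$ with $\ell\ge 4$. If $G$ has the maximum $Q$-index among all connected $F$-free outerplanar graphs on $n$ vertices, then $G$ contains the star $K_{1,n-1}$ as a subgraph (equivalently, $G$ has a vertex of degree $n-1$). -/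

import Mathlib

/-- The Euclidean plane. -/
abbrev Plane : Type := EuclideanSpace ℝ (Fin 2)

/-- An embedding of a graph in the plane: the vertices are distinct points, every edge is a simple
arc joining its two ends, no arc passes through a vertex other than its ends, and the arcs of two
different edges meet only in common ends. -/
structure PlaneEmbedding {V : Type*} (G : SimpleGraph V) where
  /-- the point that represents a vertex -/
  point : V → Plane
  point_injective : Function.Injective point
  /-- the arc that represents an edge, traversed from `u` to `v` -/
  arc : ∀ {u v : V}, G.Adj u v → Path (point u) (point v)
  arc_injective : ∀ {u v : V} (h : G.Adj u v), Function.Injective (arc h)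
  /-- both orientations of an edge are drawn as the same arc -/
  arc_symm : ∀ {u v : V} (h : G.Adj u v), Set.range (arc h.symm) = Set.range (arc h)
  point_mem_arc : ∀ {u v : V} (h : G.Adj u v) (w : V),
    point w ∈ Set.range (arc h) → w = u ∨ w = v
  arc_inter_arc : ∀ {u v x y : V} (h : G.Adj u v) (h' : G.Adj x y), s(u, v) ≠ s(x, y) →
    Set.range (arc h) ∩ Set.range (arc h') ⊆ point '' ({u, v} ∩ {x, y})

namespace PlaneEmbedding

/-- The subset of the plane occupied by the drawing. -/
def carrier {V : Type*} {G : SimpleGraph V} (E : PlaneEmbedding G) : Set Plane :=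
  Set.range E.point ∪ {z | ∃ (u v : V) (h : G.Adj u v), z ∈ Set.range (E.arc h)}

/-- The outer face: the unbounded connected component of the complement of the drawing. -/
def outerFace {V : Type*} {G : SimpleGraph V} (E : PlaneEmbedding G) : Set Plane :=
  {z | z ∈ E.carrierᶜ ∧ ¬ Bornology.IsBounded (connectedComponentIn E.carrierᶜ z)}

end PlaneEmbedding

/-- A graph is outerplanar if it has an embedding in the plane such that all vertices lie on the
boundary of the outer face. -/
def IsOuterplanar {V : Type*} (G : SimpleGraph V) : Prop :=
  ∃ E : PlaneEmbedding G, ∀ v : V, E.point v ∈ frontier E.outerFace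

open Classical in
/-- The signless Laplacian matrix `Q(G) = D(G) + A(G)`. -/
noncomputable def signlessLaplacian {V : Type*} [Fintype V] (G : SimpleGraph V) :
    Matrix V V ℝ :=
  G.degMatrix ℝ + G.adjMatrix ℝ

open Classical in
/-- The `Q`-index `q(G)`: the largest eigenvalue of the signless Laplacian matrix. -/
noncomputable def qIndex {V : Type*} [Fintype V] (G : SimpleGraph V) : ℝ :=
  sSup {μ : ℝ | Module.End.HasEigenvalue (Matrix.toLin' (signlessLaplacian G)) μ}

/-- The disjoint union of `t` copies of the graph `H`. -/
def disjointCopies {W : Type*} (t : ℕ) (H : SimpleGraph W) : SimpleGraph (Fin t × W) where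
  Adj x y := x.1 = y.1 ∧ H.Adj x.2 y.2
  symm := ⟨fun _ _ h => ⟨h.1.symm, h.2.symm⟩⟩
  loopless := ⟨fun _ h => H.loopless.irrefl _ h.2⟩

/-- `G` belongs to the class of connected `F`-free outerplanar graphs
(`F`-free: no subgraph, induced or not, is isomorphic to `F`). -/
def IsConnectedFreeOuterplanar {V W : Type*} (F : SimpleGraph W) (G : SimpleGraph V) : Prop :=
  G.Connected ∧ F.Free G ∧ IsOuterplanar G

/-- `G` maximizes the `Q`-index among all connected `F`-free outerplanar graphs with the same
number of vertices, which may be taken to have the same vertex set. -/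
def MaximizesQIndex {V W : Type*} [Fintype V] (F : SimpleGraph W) (G : SimpleGraph V) : Prop :=
  IsConnectedFreeOuterplanar F G ∧
    ∀ H : SimpleGraph V, IsConnectedFreeOuterplanar F H → qIndex H ≤ qIndex G

/-! The star on all n vertices is `F`-free and has Q-index at least n, so an extremal graph has
Q-index at least n (`card_le_qIndex_star`). Everything else bounds the Q-index of a graph without a
dominating vertex.

Two facts about outerplanar graphs suffice: two vertices have at most two common neighbours, and
every neighbourhood induces a forest. Both come from joining a point of the outer face to the
vertices by curves. A `K₂,₃` would then become a drawing of `K₃,₃`, and a wheel a drawing of `K₅`,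
in which nonadjacent edges are disjoint. A parity argument with continuous logarithms excludes both
drawings (`no_planar_drawing_K33`, `no_planar_drawing_K5`).

If all degrees are at most n - 3, counting the edges around a neighbourhood bounds the sum of the
degrees of the neighbours of a vertex. The degree vector, slightly raised at a vertex of maximum
degree, then certifies that the Q-index is below n (`IsOuterplanar.qIndex_lt_card`). Hence some u
has degree at least n - 2.

If u misses exactly one vertex w, delete the edges at w and attach w to u. The result is still
outerplanar, because the neighbourhood of u is a linear forest and so the new graph can be drawn as
a fan. It is still `F`-free, for different reasons for cycles and for unions of paths. Its Q-index
is strictly larger: w has at most two neighbours, and their eigenvector entries are at most half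
that of u (`IsOuterplanar.qIndex_lt_qIndex_movePendant`). This contradicts extremality. -/

/-! ### Parity obstruction to drawing `K₅` and `K₃,₃` -/

theorem exists_continuous_log {A : Type*} [TopologicalSpace A] [SimplyConnectedSpace A]
    [LocallyPathConnectedSpace A] (f : C(A, ℂ)) (hf : ∀ a, f a ≠ 0) :
    ∃ F : C(A, ℂ), ∀ a, Complex.exp (F a) = f a := by
  obtain ⟨a₀⟩ : Nonempty A := inferInstance
  obtain ⟨F, ⟨-, hF⟩, -⟩ := Complex.isCoveringMapOn_exp.existsUnique_continuousMap_lifts f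
    (a₀ := a₀) (Complex.exp_log (hf a₀)) (fun a => by simpa using hf a)
  exact ⟨F, fun a => congrFun hF a⟩

theorem continuous_log_unique {A : Type*} [TopologicalSpace A] [SimplyConnectedSpace A]
    [LocallyPathConnectedSpace A] {F F' : C(A, ℂ)} (h : ∀ a, Complex.exp (F a) = Complex.exp (F' a))
    {a₀ : A} (h₀ : F a₀ = F' a₀) : F = F' := by
  have := Complex.isCoveringMapOn_exp.existsUnique_continuousMap_lifts
    (⟨fun a => Complex.exp (F a), by fun_prop⟩ : C(A, ℂ)) (a₀ := a₀) (e₀ := F a₀) rfl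
    (fun a => by simp [Complex.exp_ne_zero])
  refine this.unique ⟨rfl, rfl⟩ ⟨h₀.symm, ?_⟩
  ext a
  simpa using (h a).symm

open Classical in
/-- The increment from `0` to `1` of a continuous logarithm of `γ - p`. -/
noncomputable def logIncrement (γ : C(ℝ, ℂ)) (p : ℂ) : ℂ :=
  if h : ∃ F : C(ℝ, ℂ), ∀ s, Complex.exp (F s) = γ s - p then h.choose 1 - h.choose 0 else 0

/-- Two continuous logarithms of proportional functions differ by a constant on the connected line,
so the increment is independent of the choice. The factor `c` makes room for `c = -1`, which
exchanges the roles of curve and base point. -/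
theorem logIncrement_eq {γ : C(ℝ, ℂ)} {p c : ℂ} (hc : c ≠ 0) {F : C(ℝ, ℂ)}
    (hF : ∀ s, Complex.exp (F s) = c * (γ s - p)) : logIncrement γ p = F 1 - F 0 := by
  have h : ∃ F : C(ℝ, ℂ), ∀ s, Complex.exp (F s) = γ s - p := by
    refine ⟨⟨fun s => F s - Complex.log c, by fun_prop⟩, fun s => ?_⟩
    simp only [ContinuousMap.coe_mk, Complex.exp_sub, Complex.exp_log hc, hF]
    field_simp
  rw [logIncrement, dif_pos h]
  set H := h.choose
  have hH : ∀ s, Complex.exp (H s) = γ s - p := h.choose_spec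
  have hK : F = ⟨fun s => H s + (F 0 - H 0), by fun_prop⟩ := by
    refine continuous_log_unique (a₀ := (0 : ℝ)) (fun s => ?_) (by simp)
    have h0 : γ 0 - p ≠ 0 := by rw [← hH 0]; exact Complex.exp_ne_zero _
    simp only [ContinuousMap.coe_mk, Complex.exp_add, Complex.exp_sub, hH, hF]
    field_simp
  have h1 := congrArg (fun f : C(ℝ, ℂ) => f 1) hK
  simp only [ContinuousMap.coe_mk] at h1
  rw [h1]; ring

theorem exp_logIncrement {γ : C(ℝ, ℂ)} {p : ℂ} (h : ∀ s, γ s ≠ p) :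
    Complex.exp (logIncrement γ p) * (γ 0 - p) = γ 1 - p := by
  obtain ⟨F, hF⟩ := exists_continuous_log (⟨fun s => γ s - p, by fun_prop⟩ : C(ℝ, ℂ))
    (fun s => sub_ne_zero.2 (h s))
  simp only [ContinuousMap.coe_mk] at hF
  rw [logIncrement_eq one_ne_zero (F := F) (by simpa using hF), Complex.exp_sub, hF, hF]
  exact div_mul_cancel₀ _ (sub_ne_zero.2 (h 0))

/-- Disjointness gives `γ s - δ t` a logarithm on the whole plane of parameters, and its increments
around the boundary of the unit square cancel. -/
theorem logIncrement_square {γ δ : C(ℝ, ℂ)} (h : ∀ s t, γ s ≠ δ t) :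
    logIncrement γ (δ 0) + logIncrement δ (γ 1) - logIncrement γ (δ 1) - logIncrement δ (γ 0)
      = 0 := by
  obtain ⟨F, hF⟩ := exists_continuous_log
    (⟨fun z : ℝ × ℝ => γ z.1 - δ z.2, by fun_prop⟩ : C(ℝ × ℝ, ℂ))
    (fun z => sub_ne_zero.2 (h z.1 z.2))
  simp only [ContinuousMap.coe_mk] at hF
  have h1 : ∀ t, logIncrement γ (δ t) = F (1, t) - F (0, t) := fun t =>
    logIncrement_eq one_ne_zero (F := ⟨fun s => F (s, t), by fun_prop⟩)
      (fun s => by simp [hF])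
  have h2 : ∀ s, logIncrement δ (γ s) = F (s, 1) - F (s, 0) := fun s =>
    logIncrement_eq (c := -1) (by simp) (F := ⟨fun t => F (s, t), by fun_prop⟩)
      (fun t => by simp [hF])
  rw [h1, h1, h2, h2]; ring

section Offset

variable {ι : Type*} [LinearOrder ι] (p : ι → ℂ)

/-- A logarithm of `p x - p y`, chosen so that reversing a pair of indices adds `±π i`. -/
noncomputable def pairLog (x y : ι) : ℂ :=
  if x < y then Complex.log (p x - p y) else Complex.log (p y - p x) + Real.pi * Complex.I

/-- `0` or `1` according to whether `pairLog p x y` is unshifted or shifted by `π i`. -/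
def orderSign (x y : ι) : ℤ := if x < y then 0 else 1

theorem exp_pairLog {x y : ι} (h : p x ≠ p y) : Complex.exp (pairLog p x y) = p x - p y := by
  unfold pairLog
  split_ifs
  · exact Complex.exp_log (sub_ne_zero.2 h)
  · rw [Complex.exp_add, Complex.exp_log (sub_ne_zero.2 h.symm), Complex.exp_pi_mul_I]; ring

theorem pairLog_sub_pairLog {x y : ι} (h : x ≠ y) :
    pairLog p x y - pairLog p y x =
      (orderSign x y - orderSign y x : ℤ) * (Real.pi * Complex.I) := by
  rcases lt_or_gt_of_ne h with h | h <;> simp [pairLog, orderSign, h, h.not_gt]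

/-- The number of extra turns that `γ`, a curve from `p a` to `p b`, makes around `p c`. -/
noncomputable def turns (a b c : ι) (γ : C(ℝ, ℂ)) : ℤ :=
  round (((logIncrement γ (p c) - (pairLog p b c - pairLog p a c)) / (2 * Real.pi * Complex.I)).re)

variable {p}

/-- Both sides without the `turns` term have the same exponential, so they differ by an integer
multiple of `2πi`. This makes the rounding in `turns` exact. -/
theorem logIncrement_eq_turns {a b c : ι} {γ : C(ℝ, ℂ)} (h0 : γ 0 = p a) (h1 : γ 1 = p b)
    (h : ∀ s, γ s ≠ p c) :
    logIncrement γ (p c) = pairLog p b c - pairLog p a c +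
      turns p a b c γ * (2 * Real.pi * Complex.I) := by
  have hb : p b ≠ p c := h1 ▸ h 1
  have ha : p a ≠ p c := h0 ▸ h 0
  have he : Complex.exp (logIncrement γ (p c)) =
      Complex.exp (pairLog p b c - pairLog p a c) := by
    rw [Complex.exp_sub, exp_pairLog p hb, exp_pairLog p ha, eq_div_iff (sub_ne_zero.2 ha),
      ← h0, ← h1, exp_logIncrement h]
  obtain ⟨k, hk⟩ := Complex.exp_eq_exp_iff_exists_int.1 he
  have hpi : (2 * Real.pi * Complex.I : ℂ) ≠ 0 := Complex.two_pi_I_ne_zero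
  have : turns p a b c γ = k := by
    rw [turns, hk, add_sub_cancel_left, mul_div_cancel_right₀ _ hpi]
    simp
  rw [this, hk]

/-- This is `logIncrement_square` divided by `πi`. Half of the `orderSign` part is odd exactly when
the pairs `{a, b}` and `{c, d}` interlace in the order of the indices, so modulo 2 the identity
compares the drawing with a convex one. -/
theorem turns_square {a b c d : ι} (hac : a ≠ c) (had : a ≠ d) (hbc : b ≠ c) (hbd : b ≠ d)
    {γ δ : C(ℝ, ℂ)} (ha : γ 0 = p a) (hb : γ 1 = p b) (hc : δ 0 = p c) (hd : δ 1 = p d)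
    (h : ∀ s t, γ s ≠ δ t) :
    2 * (turns p a b c γ - turns p a b d γ + turns p c d b δ - turns p c d a δ) +
      (orderSign b c - orderSign c b) - (orderSign a c - orderSign c a)
      - (orderSign b d - orderSign d b) + (orderSign a d - orderSign d a) = 0 := by
  have key := logIncrement_square h
  rw [ha, hb, hc, hd, logIncrement_eq_turns ha hb (fun s => hc ▸ h s 0),
    logIncrement_eq_turns ha hb (fun s => hd ▸ h s 1),
    logIncrement_eq_turns hc hd (fun s => hb ▸ (h 1 s).symm),
    logIncrement_eq_turns hc hd (fun s => ha ▸ (h 0 s).symm)] at key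
  have hpi : (Real.pi * Complex.I : ℂ) ≠ 0 := by simp [Real.pi_ne_zero]
  have e1 := pairLog_sub_pairLog p hbc
  have e2 := pairLog_sub_pairLog p hac
  have e3 := pairLog_sub_pairLog p hbd
  have e4 := pairLog_sub_pairLog p had
  push_cast at e1 e2 e3 e4
  have : ((2 * (turns p a b c γ - turns p a b d γ + turns p c d b δ - turns p c d a δ) +
      (orderSign b c - orderSign c b) - (orderSign a c - orderSign c a)
      - (orderSign b d - orderSign d b) + (orderSign a d - orderSign d a) : ℤ) : ℂ) *
      (Real.pi * Complex.I) = 0 := by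
    push_cast
    linear_combination key - e1 + e2 + e3 - e4
  exact_mod_cast (mul_eq_zero.1 this).resolve_right hpi

end Offset

/-- `K₅` cannot be drawn in the plane so that nonadjacent edges are disjoint. -/
theorem no_planar_drawing_K5 (p : Fin 5 → ℂ) (γ : Fin 5 → Fin 5 → C(ℝ, ℂ))
    (h0 : ∀ i j, i < j → γ i j 0 = p i) (h1 : ∀ i j, i < j → γ i j 1 = p j)
    (h : ∀ i j k l, i < j → k < l → i ≠ k → i ≠ l → j ≠ k → j ≠ l → i < k →
      ∀ s t, γ i j s ≠ γ k l t) : False := by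
  have key : ∀ i j k l : Fin 5,
      (i < j ∧ k < l ∧ i ≠ k ∧ i ≠ l ∧ j ≠ k ∧ j ≠ l ∧ i < k) → _ :=
    fun i j k l ⟨hij, hkl, hik, hil, hjk, hjl, hlt⟩ =>
      turns_square (p := p) hik hil hjk hjl (h0 i j hij) (h1 i j hij) (h0 k l hkl) (h1 k l hkl)
        (h i j k l hij hkl hik hil hjk hjl hlt)
  have k1 := key 0 1 2 3 (by decide)
  have k2 := key 0 1 2 4 (by decide)
  have k3 := key 0 1 3 4 (by decide)
  have k4 := key 0 2 1 3 (by decide)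
  have k5 := key 0 2 1 4 (by decide)
  have k6 := key 0 2 3 4 (by decide)
  have k7 := key 0 3 1 2 (by decide)
  have k8 := key 0 3 1 4 (by decide)
  have k9 := key 0 3 2 4 (by decide)
  have k10 := key 0 4 1 2 (by decide)
  have k11 := key 0 4 1 3 (by decide)
  have k12 := key 0 4 2 3 (by decide)
  have k13 := key 1 2 3 4 (by decide)
  have k14 := key 1 3 2 4 (by decide)
  have k15 := key 1 4 2 3 (by decide)
  have hs : ∀ i j : Fin 5, orderSign i j = if i < j then 0 else 1 := fun _ _ => rfl
  simp [hs] at k1 k2 k3 k4 k5 k6 k7 k8 k9 k10 k11 k12 k13 k14 k15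
  -- Modulo 2 each number of turns occurs in two of the fifteen halved equations and cancels in
  -- their sum. The constants add up to 5, the number of interlacing pairs of edges, which is odd.
  omega

/-- `K₃,₃` cannot be drawn in the plane so that nonadjacent edges are disjoint. -/
theorem no_planar_drawing_K33 (p q : Fin 3 → ℂ) (γ : Fin 3 → Fin 3 → C(ℝ, ℂ))
    (h0 : ∀ i j, γ i j 0 = p i) (h1 : ∀ i j, γ i j 1 = q j)
    (h : ∀ i j k l, i ≠ k → j ≠ l → ∀ s t, γ i j s ≠ γ k l t) : False := by
  -- The lexicographic sum supplies one linear order on all six vertices, with one side before the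
  -- other.
  let r : Fin 3 ⊕ₗ Fin 3 → ℂ := fun x => Sum.elim p q (ofLex x)
  let L : Fin 3 → Fin 3 ⊕ₗ Fin 3 := fun i => toLex (Sum.inl i)
  let R : Fin 3 → Fin 3 ⊕ₗ Fin 3 := fun i => toLex (Sum.inr i)
  have key : ∀ i j k l : Fin 3, i ≠ k → j ≠ l → _ :=
    fun i j k l hik hjl =>
      turns_square (p := r) (a := L i) (b := R j) (c := L k)
        (d := R l) (by simpa [L] using hik) (by simp [L, R]) (by simp [L, R])
        (by simpa [R] using hjl) (h0 i j) (h1 i j) (h0 k l) (h1 k l) (h i j k l hik hjl)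
  have k1 := fun j l h => key 0 j 1 l (by decide) h
  have k2 := fun j l h => key 0 j 2 l (by decide) h
  have k3 := fun j l h => key 1 j 2 l (by decide) h
  have e1 : ∀ i j : Fin 3, orderSign (L i) (L j) = if i < j then 0 else 1 := by
    intro i j; simp [orderSign, L]
  have e2 : ∀ i j : Fin 3, orderSign (R i) (R j) = if i < j then 0 else 1 := by
    intro i j; simp [orderSign, R]
  have e3 : ∀ i j : Fin 3, orderSign (L i) (R j) = 0 := by
    intro i j; simp [orderSign, L, R]
  have e4 : ∀ i j : Fin 3, orderSign (R i) (L j) = 1 := by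
    intro i j; simp [orderSign, L, R]
  simp only [e1, e2, e3, e4] at k1 k2 k3
  have a1 := k1 0 1 (by decide)
  have a2 := k1 0 2 (by decide)
  have a3 := k1 1 2 (by decide)
  have a4 := k1 1 0 (by decide)
  have a5 := k1 2 0 (by decide)
  have a6 := k1 2 1 (by decide)
  have b1 := k2 0 1 (by decide)
  have b2 := k2 0 2 (by decide)
  have b3 := k2 1 2 (by decide)
  have b4 := k2 1 0 (by decide)
  have b5 := k2 2 0 (by decide)
  have b6 := k2 2 1 (by decide)
  have c1 := k3 0 1 (by decide)
  have c2 := k3 0 2 (by decide)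
  have c3 := k3 1 2 (by decide)
  have c4 := k3 1 0 (by decide)
  have c5 := k3 2 0 (by decide)
  have c6 := k3 2 1 (by decide)
  clear k1 k2 k3 e1 e2 e3 e4 key
  simp at a1 a2 a3 a4 a5 a6 b1 b2 b3 b4 b5 b6 c1 c2 c3 c4 c5 c6
  -- The same cancellation as for `K₅`; here nine of the eighteen pairs of disjoint edges interlace.
  omega

/-! ### Topology of the outer face -/

theorem isConnected_compl_closedBall (R : ℝ) (hR : 0 ≤ R) :
    IsConnected (Metric.closedBall (0 : Plane) R)ᶜ := by
  have h1 : IsConnected ({0}ᶜ : Set Plane) := by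
    refine isConnected_compl_singleton_of_one_lt_rank ?_ 0
    rw [← Module.finrank_eq_rank, finrank_euclideanSpace_fin]
    norm_num
  -- Pushing every point radially outwards by `R` carries the punctured plane onto the complement of
  -- the ball.
  have h2 : (fun x : Plane => (1 + R / ‖x‖) • x) '' {0}ᶜ = (Metric.closedBall (0 : Plane) R)ᶜ := by
    ext y
    simp only [Set.mem_image, Set.mem_compl_iff, Set.mem_singleton_iff, mem_closedBall_zero_iff,
      not_le]
    constructor
    · rintro ⟨x, hx, rfl⟩
      have hx' : 0 < ‖x‖ := norm_pos_iff.2 hx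
      rw [norm_smul, Real.norm_of_nonneg (by positivity)]
      field_simp
      linarith
    · intro hy
      have hy' : 0 < ‖y‖ := hR.trans_lt hy
      have hc : 0 < 1 - R / ‖y‖ := by
        rw [sub_pos, div_lt_one hy']; exact hy
      refine ⟨(1 - R / ‖y‖) • y, ?_, ?_⟩
      · exact smul_ne_zero hc.ne' (norm_pos_iff.1 hy')
      · rw [norm_smul, Real.norm_of_nonneg hc.le, smul_smul]
        have : ‖y‖ - R ≠ 0 := (sub_pos.2 hy).ne'
        have : (1 + R / ((1 - R / ‖y‖) * ‖y‖)) * (1 - R / ‖y‖) = 1 := by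
          have h3 : (1 - R / ‖y‖) * ‖y‖ = ‖y‖ - R := by field_simp
          rw [h3]; field_simp; ring
        rw [this, one_smul]
  rw [← h2]
  refine h1.image _ ?_
  refine ContinuousOn.smul (continuousOn_const.add (continuousOn_const.div
    continuous_norm.continuousOn ?_)) continuousOn_id
  intro x hx; simpa using hx

/-- The identification of the Euclidean plane with `ℂ`. -/
noncomputable def planeToComplex : C(Plane, ℂ) :=
  ⟨fun z => (z 0 : ℂ) + (z 1 : ℂ) * Complex.I, by fun_prop⟩

theorem planeToComplex_injective : Function.Injective planeToComplex := by
  intro x y h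
  simp only [planeToComplex, ContinuousMap.coe_mk] at h
  have h0 := congrArg Complex.re h
  have h1 := congrArg Complex.im h
  simp at h0 h1
  ext i
  fin_cases i
  · exact h0
  · exact h1

/-- A path in the plane as a curve in `ℂ` that is constant outside `[0, 1]`. -/
noncomputable def Path.toCurve {x y : Plane} (ρ : Path x y) : C(ℝ, ℂ) :=
  planeToComplex.comp ⟨ρ.extend, ρ.continuous_extend⟩

theorem Path.toCurve_zero {x y : Plane} (ρ : Path x y) : ρ.toCurve 0 = planeToComplex x := by
  simp [Path.toCurve]

theorem Path.toCurve_one {x y : Plane} (ρ : Path x y) : ρ.toCurve 1 = planeToComplex y := by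
  simp [Path.toCurve]

theorem Path.toCurve_ne {x y x' y' : Plane} {ρ : Path x y} {σ : Path x' y'}
    (h : Disjoint (Set.range ρ) (Set.range σ)) (s t : ℝ) : ρ.toCurve s ≠ σ.toCurve t := by
  intro he
  have h1 : ρ.extend s = σ.extend t := planeToComplex_injective he
  have h2 : ρ.extend s ∈ Set.range ρ := by rw [← ρ.extend_range]; exact Set.mem_range_self s
  have h3 : σ.extend t ∈ Set.range σ := by rw [← σ.extend_range]; exact Set.mem_range_self t
  exact Set.disjoint_left.1 h h2 (h1 ▸ h3)

namespace PlaneEmbedding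

variable {V : Type*} {G : SimpleGraph V} (E : PlaneEmbedding G)

/-- The part of the drawing that represents the subgraph induced on `S`. -/
def drawing (S : Set V) : Set Plane :=
  E.point '' S ∪ ⋃ (u : V) (v : V) (h : G.Adj u v) (_ : u ∈ S) (_ : v ∈ S), Set.range (E.arc h)

variable {E}

theorem mem_drawing {S : Set V} {z : Plane} : z ∈ E.drawing S ↔
    (∃ v ∈ S, E.point v = z) ∨
      ∃ (u v : V) (h : G.Adj u v), u ∈ S ∧ v ∈ S ∧ z ∈ Set.range (E.arc h) := by
  simp only [drawing, Set.mem_union, Set.mem_image, Set.mem_iUnion, exists_prop]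

theorem drawing_mono {S T : Set V} (h : S ⊆ T) : E.drawing S ⊆ E.drawing T := by
  intro z hz
  rw [mem_drawing] at hz ⊢
  rcases hz with ⟨v, hv, rfl⟩ | ⟨u, v, ha, hu, hv, hz⟩
  · exact Or.inl ⟨v, h hv, rfl⟩
  · exact Or.inr ⟨u, v, ha, h hu, h hv, hz⟩

theorem drawing_univ : E.drawing Set.univ = E.carrier := by
  ext z
  rw [mem_drawing]
  simp [carrier]

theorem range_arc_subset_drawing {u v : V} (h : G.Adj u v) :
    Set.range (E.arc h) ⊆ E.drawing {u, v} := fun _ hz =>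
  mem_drawing.2 (Or.inr ⟨u, v, h, by simp, by simp, hz⟩)

theorem disjoint_drawing {S T : Set V} (h : Disjoint S T) :
    Disjoint (E.drawing S) (E.drawing T) := by
  rw [Set.disjoint_left] at h ⊢
  intro z hz hz'
  rw [mem_drawing] at hz hz'
  rcases hz with ⟨v, hv, rfl⟩ | ⟨u, v, ha, hu, hv, hz⟩ <;>
    rcases hz' with ⟨v', hv', he⟩ | ⟨u', v', ha', hu', hv', hz'⟩
  · exact h hv (E.point_injective he ▸ hv')
  · rcases E.point_mem_arc ha' v hz' with rfl | rfl
    · exact h hv hu'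
    · exact h hv hv'
  · rcases E.point_mem_arc ha v' (he ▸ hz) with rfl | rfl
    · exact h hu hv'
    · exact h hv hv'
  · have hne : s(u, v) ≠ s(u', v') := by
      intro he
      have : u ∈ s(u', v') := he ▸ Sym2.mem_mk_left u v
      rcases Sym2.mem_iff.1 this with rfl | rfl
      · exact h hu hu'
      · exact h hu hv'
    obtain ⟨w, ⟨hw, hw'⟩, -⟩ := E.arc_inter_arc ha ha' hne ⟨hz, hz'⟩
    have h1 : w ∈ S := by rcases hw with rfl | rfl <;> assumption
    have h2 : w ∈ T := by rcases hw' with rfl | rfl <;> assumption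
    exact h h1 h2

variable (E) in
/-- The curve traced by a walk. -/
noncomputable def walkPath : ∀ {u v : V}, G.Walk u v → Path (E.point u) (E.point v)
  | _, _, .nil => Path.refl _
  | _, _, .cons h p => (E.arc h).trans (walkPath p)

theorem range_walkPath_subset {u v : V} (p : G.Walk u v) :
    Set.range (E.walkPath p) ⊆ E.drawing {x | x ∈ p.support} := by
  induction p with
  | nil =>
    rintro z ⟨s, rfl⟩
    exact mem_drawing.2 (Or.inl ⟨_, by simp, rfl⟩)
  | cons h p ih =>
    rw [walkPath, Path.trans_range]
    refine Set.union_subset ((range_arc_subset_drawing h).trans (drawing_mono ?_))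
      (ih.trans (drawing_mono fun x hx => by simpa using Or.inr hx))
    rintro x (rfl | rfl) <;> simp

section Finite

variable [Finite V]

variable (E) in
theorem isCompact_drawing (S : Set V) : IsCompact (E.drawing S) := by
  refine (S.toFinite.image _).isCompact.union ?_
  refine isCompact_iUnion fun u => isCompact_iUnion fun v => isCompact_iUnion fun h =>
    isCompact_iUnion fun _ => isCompact_iUnion fun _ => isCompact_range (E.arc h).continuous

variable (E) in
theorem isOpen_compl_carrier : IsOpen E.carrierᶜ := by
  rw [← drawing_univ]
  exact (E.isCompact_drawing _).isClosed.isOpen_compl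

/-- The drawing lies in a ball whose complement is connected. Every unbounded component meets that
complement, hence contains it, so there is only one. -/
theorem outerFace_eq {x : Plane} (hx : x ∈ E.outerFace) :
    E.outerFace = connectedComponentIn E.carrierᶜ x := by
  obtain ⟨R, hR0, hR⟩ : ∃ R, 0 ≤ R ∧ E.carrier ⊆ Metric.closedBall 0 R := by
    have := (E.isCompact_drawing Set.univ).isBounded
    rw [drawing_univ] at this
    obtain ⟨R, hR⟩ := this.subset_closedBall 0
    exact ⟨max R 0, le_max_right _ _, hR.trans (Metric.closedBall_subset_closedBall (le_max_left _ _))⟩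
  have far : ∀ y ∈ E.outerFace, ∃ z ∈ connectedComponentIn E.carrierᶜ y,
      z ∈ (Metric.closedBall (0 : Plane) R)ᶜ := by
    intro y hy
    by_contra! hc
    refine hy.2 ((Metric.isBounded_closedBall (x := (0 : Plane)) (r := R)).subset fun z hz => ?_)
    exact not_not.1 (hc z hz)
  obtain ⟨a, ha, ha'⟩ := far x hx
  have hsub : (Metric.closedBall (0 : Plane) R)ᶜ ⊆ E.carrierᶜ := Set.compl_subset_compl.2 hR
  have hconn := (isConnected_compl_closedBall R hR0).isPreconnected
  ext y
  constructor
  · intro hy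
    obtain ⟨b, hb, hb'⟩ := far y hy
    have h1 : b ∈ connectedComponentIn E.carrierᶜ a :=
      hconn.subset_connectedComponentIn ha' hsub hb'
    rw [connectedComponentIn_eq ha, connectedComponentIn_eq h1, ← connectedComponentIn_eq hb]
    exact mem_connectedComponentIn hy.1
  · intro hy
    refine ⟨connectedComponentIn_subset _ _ hy, ?_⟩
    rw [← connectedComponentIn_eq hy]
    exact hx.2

theorem isPathConnected_outerFace (h : E.outerFace.Nonempty) : IsPathConnected E.outerFace := by
  obtain ⟨x, hx⟩ := h
  rw [outerFace_eq hx]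
  have ho : IsOpen (connectedComponentIn E.carrierᶜ x) :=
    E.isOpen_compl_carrier.connectedComponentIn
  exact (ho.isConnected_iff_isPathConnected).1 (isConnected_connectedComponentIn_iff.2 hx.1)

/-- If all vertices lie on the boundary of the outer face, then they can be joined to a common
point of the outer face without crossing the parts of the drawing away from them. -/
theorem exists_paths_to_outer_point [Nonempty V] (hE : ∀ v, E.point v ∈ frontier E.outerFace) :
    ∃ (o : Plane) (ρ : ∀ v, Path o (E.point v)), ∀ (v : V) (S : Set V), v ∉ S →
      Disjoint (Set.range (ρ v)) (E.drawing S) := by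
  obtain ⟨v₀⟩ := ‹Nonempty V›
  have hne : E.outerFace.Nonempty :=
    closure_nonempty_iff.1 ⟨_, frontier_subset_closure (hE v₀)⟩
  obtain ⟨o, ho, hjoin⟩ := isPathConnected_outerFace hne
  have key : ∀ v, ∃ ρ : Path o (E.point v), ∀ S : Set V, v ∉ S →
      Disjoint (Set.range ρ) (E.drawing S) := by
    intro v
    have hv : E.point v ∈ (E.drawing {v}ᶜ)ᶜ := by
      intro hmem
      refine Set.disjoint_left.1 (disjoint_drawing (E := E) (S := {v}) (T := {v}ᶜ)
        disjoint_compl_right) ?_ hmem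
      exact mem_drawing.2 (Or.inl ⟨v, rfl, rfl⟩)
    -- The final segment may cross arcs ending at `v`. Only the part of the drawing away from `v`
    -- has to be avoided, and it is closed.
    obtain ⟨ε, hε, hball⟩ := Metric.isOpen_iff.1
      (E.isCompact_drawing {v}ᶜ).isClosed.isOpen_compl _ hv
    obtain ⟨z, hz, hzd⟩ := Metric.mem_closure_iff.1 (frontier_subset_closure (hE v)) ε hε
    obtain ⟨σ, hσ⟩ := hjoin hz
    refine ⟨σ.trans (Path.segment z (E.point v)), fun S hS => ?_⟩
    rw [Path.trans_range, Path.range_segment, Set.disjoint_union_left]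
    constructor
    · rw [Set.disjoint_left]
      rintro _ ⟨s, rfl⟩ hs
      exact (hσ s).1 (drawing_univ (E := E) ▸ drawing_mono (Set.subset_univ S) hs)
    · rw [Set.disjoint_left]
      intro y hy hyS
      have h1 : y ∈ Metric.ball (E.point v) ε :=
        (convex_ball _ _).segment_subset (by rwa [Metric.mem_ball, dist_comm])
          (Metric.mem_ball_self hε) hy
      exact hball h1 (drawing_mono (fun x hx => by rintro rfl; exact hS hx) hyS)
  choose ρ hρ using key
  exact ⟨o, ρ, hρ⟩

end Finite

end PlaneEmbedding

/-! ### Forbidden configurations in outerplanar graphs -/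

open PlaneEmbedding in
/-- An outerplanar graph contains no `K₂,₃`. -/
theorem IsOuterplanar.no_three_common_neighbors {V : Type*} [Finite V] {G : SimpleGraph V}
    (hG : IsOuterplanar G) {a b : V} (hab : a ≠ b) (w : Fin 3 → V) (hw : Function.Injective w)
    (ha : ∀ i, G.Adj a (w i)) (hb : ∀ i, G.Adj b (w i)) : False := by
  obtain ⟨E, hE⟩ := hG
  have : Nonempty V := ⟨a⟩
  obtain ⟨o, ρ, hρ⟩ := exists_paths_to_outer_point hE
  have hab' : ∀ j l, j ≠ l → Disjoint (Set.range (E.arc (ha j))) (Set.range (E.arc (hb l))) := by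
    intro j l hjl
    refine (disjoint_drawing (E := E) (S := {a, w j}) (T := {b, w l}) ?_).mono
      (range_arc_subset_drawing _) (range_arc_subset_drawing _)
    have := hw.ne hjl
    have h1 := (ha l).ne
    have h2 := (hb j).ne
    simp [hab.symm, this.symm, h2, h1.symm]
  have hxo : ∀ x (hx : ∀ i, G.Adj x (w i)) j l, j ≠ l →
      Disjoint (Set.range (E.arc (hx j))) (Set.range (ρ (w l))) := by
    intro x hx j l hjl
    refine ((hρ (w l) {x, w j} ?_).mono_right (range_arc_subset_drawing _)).symm
    simp [(hx l).ne', hw.ne hjl.symm]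
  -- The outer point serves as the third common neighbour of the `w j`.
  refine no_planar_drawing_K33 (fun i => planeToComplex (![E.point a, E.point b, o] i))
    (fun j => planeToComplex (E.point (w j)))
    ![fun j => (E.arc (ha j)).toCurve, fun j => (E.arc (hb j)).toCurve, fun j => (ρ (w j)).toCurve]
    ?_ ?_ ?_
  · intro i j; fin_cases i <;> exact Path.toCurve_zero _
  · intro i j; fin_cases i <;> exact Path.toCurve_one _
  · intro i j k l hik hjl
    fin_cases i <;> fin_cases k <;> first | exact absurd rfl hik | skip
    · exact Path.toCurve_ne (hab' j l hjl)
    · exact Path.toCurve_ne (hxo a ha j l hjl)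
    · exact Path.toCurve_ne (hab' l j hjl.symm).symm
    · exact Path.toCurve_ne (hxo b hb j l hjl)
    · exact Path.toCurve_ne (hxo a ha l j hjl.symm).symm
    · exact Path.toCurve_ne (hxo b hb l j hjl.symm).symm

open PlaneEmbedding in
/-- An outerplanar graph contains no wheel: if `a`, `b`, `c` are neighbours of `u` and
`b` is adjacent to `a` and `c`, then `a` and `c` are not connected avoiding `u` and `b`. -/
theorem IsOuterplanar.no_wheel {V : Type*} [Finite V] {G : SimpleGraph V}
    (hG : IsOuterplanar G) {u a b c : V} (hac : a ≠ c) (ha : G.Adj u a) (hb : G.Adj u b)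
    (hc : G.Adj u c) (hab : G.Adj a b) (hbc : G.Adj b c) (q : G.Walk a c)
    (huq : u ∉ q.support) (hbq : b ∉ q.support) : False := by
  obtain ⟨E, hE⟩ := hG
  have : Nonempty V := ⟨a⟩
  obtain ⟨o, ρ, hρ⟩ := exists_paths_to_outer_point hE
  have henum : ∀ i j k l : Fin 5, i < j → k < l → i ≠ k → i ≠ l → j ≠ k → j ≠ l → i < k →
      (i, j, k, l) ∈ ([
        (0, 1, 2, 3), (0, 1, 2, 4), (0, 1, 3, 4), (0, 2, 1, 3), (0, 2, 1, 4),
        (0, 2, 3, 4), (0, 3, 1, 2), (0, 3, 1, 4), (0, 3, 2, 4), (0, 4, 1, 2),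
        (0, 4, 1, 3), (0, 4, 2, 3), (1, 2, 3, 4), (1, 3, 2, 4), (1, 4, 2, 3)] :
        List (Fin 5 × Fin 5 × Fin 5 × Fin 5)) := by decide
  have hlt : ∀ i j : Fin 5, i < j →
      (i = 0 ∧ j = 1) ∨ (i = 0 ∧ j = 2) ∨ (i = 0 ∧ j = 3) ∨ (i = 0 ∧ j = 4) ∨ (i = 1 ∧ j = 2) ∨
      (i = 1 ∧ j = 3) ∨ (i = 1 ∧ j = 4) ∨ (i = 2 ∧ j = 3) ∨ (i = 2 ∧ j = 4) ∨
      (i = 3 ∧ j = 4) := by decide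
  have arcs : ∀ {x y z t : V} (h : G.Adj x y) (h' : G.Adj z t), Disjoint ({x, y} : Set V) {z, t} →
      Disjoint (Set.range (E.arc h)) (Set.range (E.arc h')) := fun h h' hd =>
    (disjoint_drawing hd).mono (range_arc_subset_drawing _) (range_arc_subset_drawing _)
  have arcq : ∀ {x y : V} (h : G.Adj x y), x ∉ q.support → y ∉ q.support →
      Disjoint (Set.range (E.arc h)) (Set.range (E.walkPath q)) := fun h hx hy =>
    (disjoint_drawing (by simp [hx, hy])).mono (range_arc_subset_drawing _)
      (range_walkPath_subset q)
  have outs : ∀ {x y z : V} (h : G.Adj y z), x ≠ y → x ≠ z →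
      Disjoint (Set.range (ρ x)) (Set.range (E.arc h)) := fun h hy hz =>
    (hρ _ _ (by simp [hy, hz])).mono_right (range_arc_subset_drawing h)
  have outq : ∀ {x : V}, x ∉ q.support →
      Disjoint (Set.range (ρ x)) (Set.range (E.walkPath q)) := fun hx =>
    (hρ _ _ hx).mono_right (range_walkPath_subset q)
  -- The outer point is the fifth vertex, and the walk `q` replaces the edge from `a` to `c`.
  refine no_planar_drawing_K5
    (fun i => planeToComplex (![o, E.point u, E.point a, E.point b, E.point c] i))
    ![![0, (ρ u).toCurve, (ρ a).toCurve, (ρ b).toCurve, (ρ c).toCurve],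
      ![0, 0, (E.arc ha).toCurve, (E.arc hb).toCurve, (E.arc hc).toCurve],
      ![0, 0, 0, (E.arc hab).toCurve, (E.walkPath q).toCurve],
      ![0, 0, 0, 0, (E.arc hbc).toCurve], ![0, 0, 0, 0, 0]]
    ?_ ?_ ?_
  · intro i j hij
    rcases hlt i j hij with h | h | h | h | h | h | h | h | h | h <;>
      (obtain ⟨rfl, rfl⟩ := h; exact Path.toCurve_zero _)
  · intro i j hij
    rcases hlt i j hij with h | h | h | h | h | h | h | h | h | h <;>
      (obtain ⟨rfl, rfl⟩ := h; exact Path.toCurve_one _)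
  · intro i j k l h1 h2 h3 h4 h5 h6 h7
    have n1 := ha.ne
    have n2 := hb.ne
    have n3 := hc.ne
    have n4 := hab.ne
    have n5 := hbc.ne
    have hm := henum i j k l h1 h2 h3 h4 h5 h6 h7
    simp only [List.mem_cons, Prod.mk.injEq, List.not_mem_nil, or_false] at hm
    rcases hm with
      h | h | h | h | h | h | h | h | h | h | h | h | h | h | h <;>
      obtain ⟨rfl, rfl, rfl, rfl⟩ := h
    · exact Path.toCurve_ne (outs hab n1 n2)
    · exact Path.toCurve_ne (outq huq)
    · exact Path.toCurve_ne (outs hbc n2 n3)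
    · exact Path.toCurve_ne (outs hb n1.symm n4)
    · exact Path.toCurve_ne (outs hc n1.symm hac)
    · exact Path.toCurve_ne (outs hbc n4 hac)
    · exact Path.toCurve_ne (outs ha n2.symm n4.symm)
    · exact Path.toCurve_ne (outs hc n2.symm n5)
    · exact Path.toCurve_ne (outq hbq)
    · exact Path.toCurve_ne (outs ha n3.symm hac.symm)
    · exact Path.toCurve_ne (outs hb n3.symm n5.symm)
    · exact Path.toCurve_ne (outs hab hac.symm n5.symm)
    · exact Path.toCurve_ne (arcs ha hbc (by grind))
    · exact Path.toCurve_ne (arcq hb huq hbq)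
    · exact Path.toCurve_ne (arcs hc hab (by grind))

/-! ### Fans are outerplanar -/

namespace PlaneEmbedding

variable {V : Type*} {G : SimpleGraph V} {E : PlaneEmbedding G}

/-- A connected unbounded set that misses the drawing lies in the outer face. -/
theorem subset_outerFace {C : Set Plane} (hC : IsPreconnected C) (hb : ¬ Bornology.IsBounded C)
    (hd : C ⊆ E.carrierᶜ) : C ⊆ E.outerFace := fun _ hz =>
  ⟨hd hz, fun h => hb (h.subset (hC.subset_connectedComponentIn hz hd))⟩

theorem point_mem_frontier_outerFace {v : V} {C : Set Plane} (hC : IsPreconnected C)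
    (hb : ¬ Bornology.IsBounded C) (hd : C ⊆ E.carrierᶜ) (hv : E.point v ∈ closure C) :
    E.point v ∈ frontier E.outerFace := by
  refine ⟨closure_mono (subset_outerFace hC hb hd) hv, fun h => ?_⟩
  exact (interior_subset h).1 (Or.inl ⟨v, rfl⟩)

end PlaneEmbedding

section Fan

variable {V : Type*} (u : V) (f : V → ℤ)

open Classical in
/-- The hub `u` is placed above the axis, all other vertices on the axis. -/
noncomputable def fanPoint (v : V) : Plane := if v = u then !₂[0, 1] else !₂[(f v : ℝ), 0]

variable {u f}

theorem fanPoint_hub : fanPoint u f u = !₂[0, 1] := by simp [fanPoint]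

theorem fanPoint_of_ne {v : V} (h : v ≠ u) : fanPoint u f v = !₂[(f v : ℝ), 0] := by
  simp [fanPoint, h]

theorem fanPoint_injective (hf : Set.InjOn f {u}ᶜ) : Function.Injective (fanPoint u f) := by
  intro x y h
  by_cases hx : x = u <;> by_cases hy : y = u
  · rw [hx, hy]
  · subst hx
    rw [fanPoint_hub, fanPoint_of_ne hy] at h
    simpa using congrArg (fun z : Plane => z 1) h
  · subst hy
    rw [fanPoint_hub, fanPoint_of_ne hx] at h
    simpa using congrArg (fun z : Plane => z 1) h
  · rw [fanPoint_of_ne hx, fanPoint_of_ne hy] at h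
    exact hf hx hy (by simpa using congrArg (fun z : Plane => z 0) h)

theorem mem_segment_spoke {v : V} (hv : v ≠ u) {z : Plane}
    (hz : z ∈ segment ℝ (fanPoint u f u) (fanPoint u f v)) :
    0 ≤ z 1 ∧ z 1 ≤ 1 ∧ z 0 = (1 - z 1) * f v := by
  obtain ⟨a, b, ha, hb, hab, rfl⟩ := hz
  rw [fanPoint_hub, fanPoint_of_ne hv]
  refine ⟨?_, ?_, ?_⟩ <;> simp
  · exact ha
  · linarith
  · left; linarith

theorem mem_segment_rim {x y : V} (hx : x ≠ u) (hy : y ≠ u) (hxy : f y = f x + 1) {z : Plane}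
    (hz : z ∈ segment ℝ (fanPoint u f x) (fanPoint u f y)) :
    z 1 = 0 ∧ (f x : ℝ) ≤ z 0 ∧ z 0 ≤ f x + 1 := by
  obtain ⟨a, b, ha, hb, hab, rfl⟩ := hz
  rw [fanPoint_of_ne hx, fanPoint_of_ne hy, hxy]
  obtain rfl : a = 1 - b := by linarith
  refine ⟨?_, ?_, ?_⟩ <;> simp <;> nlinarith

theorem mem_segment_fan {G : SimpleGraph V}
    (hG : ∀ x y, G.Adj x y → x ≠ u → y ≠ u → f y = f x + 1 ∨ f x = f y + 1)
    {x y : V} (h : G.Adj x y) {z : Plane}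
    (hz : z ∈ segment ℝ (fanPoint u f x) (fanPoint u f y)) :
    (∃ v, v ≠ u ∧ s(x, y) = s(u, v) ∧ 0 ≤ z 1 ∧ z 1 ≤ 1 ∧ z 0 = (1 - z 1) * f v) ∨
    ∃ a b, a ≠ u ∧ b ≠ u ∧ s(x, y) = s(a, b) ∧ f b = f a + 1 ∧ z 1 = 0 ∧ (f a : ℝ) ≤ z 0 ∧
      z 0 ≤ f a + 1 := by
  by_cases hx : x = u
  · subst hx
    exact Or.inl ⟨y, h.ne', rfl, mem_segment_spoke h.ne' hz⟩
  by_cases hy : y = u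
  · subst hy
    rw [segment_symm] at hz
    exact Or.inl ⟨x, h.ne, Sym2.eq_swap, mem_segment_spoke h.ne hz⟩
  right
  rcases hG x y h hx hy with h' | h'
  · exact ⟨x, y, hx, hy, rfl, h', mem_segment_rim hx hy h' hz⟩
  · rw [segment_symm] at hz
    exact ⟨y, x, hy, hx, Sym2.eq_swap, h', mem_segment_rim hy hx h' hz⟩

theorem eq_fanPoint_hub {z : Plane} (h0 : z 0 = 0) (h1 : z 1 = 1) : fanPoint u f u = z := by
  rw [fanPoint_hub]; ext i; fin_cases i <;> simp [h0, h1]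

theorem eq_fanPoint_of_ne {v : V} (hv : v ≠ u) {z : Plane} (h0 : z 0 = f v) (h1 : z 1 = 0) :
    fanPoint u f v = z := by
  rw [fanPoint_of_ne hv]; ext i; fin_cases i <;> simp [h0, h1]

theorem fan_segment_inter {G : SimpleGraph V} (hf : Set.InjOn f {u}ᶜ)
    (hG : ∀ x y, G.Adj x y → x ≠ u → y ≠ u → f y = f x + 1 ∨ f x = f y + 1)
    {x y x' y' : V} (h : G.Adj x y) (h' : G.Adj x' y') (hne : s(x, y) ≠ s(x', y')) {z : Plane}
    (hz : z ∈ segment ℝ (fanPoint u f x) (fanPoint u f y))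
    (hz' : z ∈ segment ℝ (fanPoint u f x') (fanPoint u f y')) :
    ∃ w, w ∈ s(x, y) ∧ w ∈ s(x', y') ∧ fanPoint u f w = z := by
  have spoke_rim : ∀ v a b : V, v ≠ u → a ≠ u → b ≠ u → f b = f a + 1 →
      z 0 = (1 - z 1) * f v → z 1 = 0 → (f a : ℝ) ≤ z 0 → z 0 ≤ f a + 1 →
      fanPoint u f v = z ∧ (v = a ∨ v = b) := by
    intro v a b hv ha hb hab h0 h1 h2 h3
    have h0' : z 0 = f v := by rw [h0, h1]; ring
    refine ⟨eq_fanPoint_of_ne hv h0' h1, ?_⟩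
    rw [h0'] at h2 h3
    have h2' : f a ≤ f v := by exact_mod_cast h2
    have h3' : f v ≤ f a + 1 := by rw [← @Int.cast_le ℝ]; push_cast; exact h3
    rcases (by omega : f v = f a ∨ f v = f b) with h | h
    · exact Or.inl (hf hv ha h)
    · exact Or.inr (hf hv hb h)
  have rim_rim : ∀ a b a' b' : V, a ≠ u → b ≠ u → a' ≠ u → b' ≠ u → f b = f a + 1 →
      f b' = f a' + 1 → z 1 = 0 → z 0 ≤ f a + 1 → (f a' : ℝ) ≤ z 0 → f a < f a' →
      fanPoint u f b = z ∧ b = a' := by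
    intro a b a' b' ha hb ha' hb' hab hab' h1 h2 h3 hlt
    have h4 : f a' ≤ f a + 1 := by rw [← @Int.cast_le ℝ]; push_cast; exact h3.trans h2
    have h5 : f b = f a' := by omega
    have h6 := hf hb ha' h5
    refine ⟨eq_fanPoint_of_ne hb (le_antisymm ?_ ?_) h1, h6⟩
    · rw [hab]; push_cast; exact h2
    · rw [h5]; exact h3
  rcases mem_segment_fan hG h hz with ⟨v, hv, e, h1, h2, h3⟩ | ⟨a, b, ha, hb, e, hab, h1, h2, h3⟩ <;>
  rcases mem_segment_fan hG h' hz' with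
    ⟨v', hv', e', h1', h2', h3'⟩ | ⟨a', b', ha', hb', e', hab', h1', h2', h3'⟩ <;>
  rw [e, e'] at hne ⊢
  · refine ⟨u, by simp, by simp, ?_⟩
    have hvv : v ≠ v' := by rintro rfl; exact hne rfl
    have hfv : (f v : ℝ) - f v' ≠ 0 := by
      rw [sub_ne_zero]; intro hc; exact hvv (hf hv hv' (by exact_mod_cast hc))
    have hz1 : (1 - z 1) * ((f v : ℝ) - f v') = 0 := by linarith
    have hz1' := (mul_eq_zero.1 hz1).resolve_right hfv
    exact eq_fanPoint_hub (by rw [h3, hz1', zero_mul]) (by linarith)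
  · obtain ⟨hp, hv'⟩ := spoke_rim v a' b' hv ha' hb' hab' h3 h1' h2' h3'
    exact ⟨v, by simp, by simpa using hv', hp⟩
  · obtain ⟨hp, hv''⟩ := spoke_rim v' a b hv' ha hb hab h3' h1 h2 h3
    exact ⟨v', by simpa using hv'', by simp, hp⟩
  · rcases lt_trichotomy (f a) (f a') with hlt | heq | hlt
    · obtain ⟨hp, rfl⟩ := rim_rim a b a' b' ha hb ha' hb' hab hab' h1 h3 h2' hlt
      exact ⟨b, by simp, by simp, hp⟩
    · exact absurd (by rw [hf ha ha' heq, hf hb hb' (by omega)]) hne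
    · obtain ⟨hp, rfl⟩ := rim_rim a' b' a b ha' hb' ha hb hab' hab h1 h3' h2 hlt
      exact ⟨b', by simp, by simp, hp⟩

theorem fanPoint_mem_segment {G : SimpleGraph V} (hf : Set.InjOn f {u}ᶜ)
    (hG : ∀ x y, G.Adj x y → x ≠ u → y ≠ u → f y = f x + 1 ∨ f x = f y + 1)
    {x y : V} (h : G.Adj x y) (w : V)
    (hw : fanPoint u f w ∈ segment ℝ (fanPoint u f x) (fanPoint u f y)) : w = x ∨ w = y := by
  rw [← Sym2.mem_iff]
  rcases mem_segment_fan hG h hw with ⟨v, hv, e, h1, h2, h3⟩ | ⟨a, b, ha, hb, e, hab, h1, h2, h3⟩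
  · rw [e]
    by_cases hwu : w = u
    · simp [hwu]
    · rw [fanPoint_of_ne hwu] at h3
      have : f w = f v := by simpa using h3
      simp [hf hwu hv this]
  · rw [e]
    by_cases hwu : w = u
    · subst hwu
      rw [fanPoint_hub] at h1
      simp at h1
    · rw [fanPoint_of_ne hwu] at h2 h3
      simp only [Matrix.cons_val_zero] at h2 h3
      have h2' : f a ≤ f w := by exact_mod_cast h2
      have h3' : f w ≤ f a + 1 := by exact_mod_cast h3
      rcases (by omega : f w = f a ∨ f w = f b) with h | h
      · simp [hf hwu ha h]
      · simp [hf hwu hb h]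

/-- The straight-line drawing of a fan-like graph: the hub `u` above the axis, every other
vertex `v` at position `f v` of the axis. -/
noncomputable def fanEmbedding (G : SimpleGraph V) (hf : Set.InjOn f {u}ᶜ)
    (hG : ∀ x y, G.Adj x y → x ≠ u → y ≠ u → f y = f x + 1 ∨ f x = f y + 1) :
    PlaneEmbedding G where
  point := fanPoint u f
  point_injective := fanPoint_injective hf
  arc {x y} _ := Path.segment (fanPoint u f x) (fanPoint u f y)
  arc_injective h := Path.segment_injective_of_ne ((fanPoint_injective hf).ne h.ne)
  arc_symm h := by simp only [Path.range_segment]; exact segment_symm ℝ _ _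
  point_mem_arc h w hw := by
    rw [Path.range_segment] at hw
    exact fanPoint_mem_segment hf hG h w hw
  arc_inter_arc h h' hne := by
    rintro z ⟨hz, hz'⟩
    rw [Path.range_segment] at hz hz'
    obtain ⟨w, hw, hw', rfl⟩ := fan_segment_inter hf hG h h' hne hz hz'
    exact ⟨w, ⟨by simpa using hw, by simpa using hw'⟩, rfl⟩

/-- The drawing lies in the strip between heights 0 and 1. The half-planes above and below it belong
to the outer face; the hub borders the upper one, all other vertices the lower one. -/
theorem isOuterplanar_of_fan (G : SimpleGraph V) (hf : Set.InjOn f {u}ᶜ)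
    (hG : ∀ x y, G.Adj x y → x ≠ u → y ≠ u → f y = f x + 1 ∨ f x = f y + 1) :
    IsOuterplanar G := by
  refine ⟨fanEmbedding G hf hG, fun v => ?_⟩
  have hstrip : ∀ z ∈ (fanEmbedding G hf hG).carrier, 0 ≤ z 1 ∧ z 1 ≤ 1 := by
    rintro z (⟨v, rfl⟩ | ⟨x, y, h, hz⟩)
    · change 0 ≤ fanPoint u f v 1 ∧ fanPoint u f v 1 ≤ 1
      by_cases hv : v = u
      · subst hv; simp [fanPoint_hub]
      · simp [fanPoint_of_ne hv]
    · change z ∈ Set.range (Path.segment (fanPoint u f x) (fanPoint u f y)) at hz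
      rw [Path.range_segment] at hz
      rcases mem_segment_fan hG h hz with ⟨_, _, _, h1, h2, _⟩ | ⟨_, _, _, _, _, _, h1, _⟩
      · exact ⟨h1, h2⟩
      · simp [h1]
  -- The sign of `σ` selects the upper or lower half-plane, so one argument covers both.
  have half : ∀ (σ c : ℝ), σ ≠ 0 → (∀ z : Plane, c < σ * z 1 → z ∉ (fanEmbedding G hf hG).carrier) →
      σ * fanPoint u f v 1 = c → fanPoint u f v ∈ frontier (fanEmbedding G hf hG).outerFace := by
    intro σ c hσ hc hv
    have hlin : ∀ (z : Plane) (t : ℝ),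
        σ * (z + EuclideanSpace.single 1 (t * σ) : Plane) 1 = σ * z 1 + t * σ ^ 2 := by
      intro z t; simp; ring
    have hσ2 : 0 < σ ^ 2 := by positivity
    refine PlaneEmbedding.point_mem_frontier_outerFace (E := fanEmbedding G hf hG)
      (C := {z : Plane | c < σ * z 1}) ?_ ?_ hc ?_
    · refine Convex.isPreconnected ?_
      intro x hx y hy a b ha hb hab
      simp only [Set.mem_ofPred_eq, PiLp.add_apply, PiLp.smul_apply, smul_eq_mul] at hx hy ⊢
      obtain rfl : a = 1 - b := by linarith
      rcases hb.eq_or_lt with rfl | hb'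
      · linarith
      · nlinarith
    · intro hb
      obtain ⟨R, hR⟩ := hb.subset_closedBall (fanPoint u f v)
      have h1 : fanPoint u f v + EuclideanSpace.single 1 ((|R| + 1) / |σ| * σ) ∈
          {z : Plane | c < σ * z 1} := by
        rw [Set.mem_ofPred_eq, hlin, hv]
        have : 0 < (|R| + 1) / |σ| * σ ^ 2 := by positivity
        linarith
      have h2 := hR h1
      rw [mem_closedBall_iff_norm, add_sub_cancel_left, PiLp.norm_single, norm_mul,
        Real.norm_eq_abs, Real.norm_eq_abs, abs_div, abs_abs,
        div_mul_cancel₀ _ (abs_ne_zero.2 hσ), abs_of_nonneg (by positivity)] at h2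
      linarith [le_abs_self R]
    · rw [Metric.mem_closure_iff]
      intro ε hε
      change ∃ b ∈ _, dist (fanPoint u f v) b < ε
      refine ⟨fanPoint u f v + EuclideanSpace.single 1 (ε / 2 / |σ| * σ), ?_, ?_⟩
      · rw [Set.mem_ofPred_eq, hlin, hv]
        have : 0 < ε / 2 / |σ| * σ ^ 2 := by positivity
        linarith
      · rw [dist_eq_norm', add_sub_cancel_left, PiLp.norm_single, norm_mul,
          Real.norm_eq_abs, Real.norm_eq_abs, abs_div, abs_abs,
          div_mul_cancel₀ _ (abs_ne_zero.2 hσ), abs_of_pos (by positivity)]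
        linarith
  by_cases hv : v = u
  · subst hv
    exact half 1 1 one_ne_zero (fun z hz hm => by linarith [(hstrip z hm).2])
      (by simp [fanPoint_hub])
  · exact half (-1) 0 (by norm_num) (fun z hz hm => by linarith [(hstrip z hm).1])
      (by simp [fanPoint_of_ne hv])

end Fan

/-! ### Degrees and neighbourhoods in outerplanar graphs -/

section Counting

open scoped Classical in
theorem IsOuterplanar.card_common_neighbors_le {V : Type*} [Fintype V] {G : SimpleGraph V}
    (hG : IsOuterplanar G) {a b : V} (hab : a ≠ b) :
    (G.neighborFinset a ∩ G.neighborFinset b).card ≤ 2 := by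
  by_contra! h
  obtain ⟨x, y, z, hx, hy, hz, hxy, hxz, hyz⟩ := Finset.two_lt_card_iff.1 h
  simp only [Finset.mem_inter, SimpleGraph.mem_neighborFinset] at hx hy hz
  refine hG.no_three_common_neighbors hab ![x, y, z] ?_ ?_ ?_
  · intro i j hij
    fin_cases i <;> fin_cases j <;> simp_all
  · intro i; fin_cases i <;> simp [hx, hy, hz]
  · intro i; fin_cases i <;> simp [hx, hy, hz]

/-- Neighbourhoods in an outerplanar graph induce forests: every nonempty set of neighbours of `u`
contains a vertex with at most one neighbour in the set. -/
theorem IsOuterplanar.exists_leaf {V : Type*} [Finite V] {G : SimpleGraph V}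
    (hG : IsOuterplanar G) {u : V} {S : Set V} (hS : ∀ x ∈ S, G.Adj u x) (hne : S.Nonempty) :
    ∃ x ∈ S, ∀ y ∈ S, ∀ z ∈ S, G.Adj x y → G.Adj x z → y = z := by
  classical
  by_contra! hc
  -- If every vertex of `S` had two neighbours in `S`, a path in `S` could always be extended at its
  -- start. Otherwise the start has, besides its successor, a neighbour further along the path, and
  -- the cycle so closed forms a wheel with hub `u`. Arbitrarily long paths contradict finiteness.
  have key : ∀ k : ℕ, ∃ (x y : V) (p : G.Walk x y), p.IsPath ∧ p.length = k ∧
      ∀ v ∈ p.support, v ∈ S := by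
    intro k
    induction k with
    | zero =>
      obtain ⟨x, hx⟩ := hne
      exact ⟨x, x, .nil, by simp, rfl, by simpa using hx⟩
    | succ k ih =>
      obtain ⟨x, y, p, hp, hlen, hsup⟩ := ih
      have hext : ∃ c ∈ S, G.Adj x c ∧ c ∉ p.support := by
        by_contra! hcon
        obtain ⟨a, ha, b, hb, hxa, hxb, hab⟩ := hc x (hsup x p.start_mem_support)
        cases p with
        | nil => exact hxa.ne' (by simpa using hcon a ha hxa)
        | @cons _ m _ h q =>
          rw [SimpleGraph.Walk.cons_isPath_iff] at hp
          obtain ⟨c, hcS, hxc, hcm⟩ : ∃ c ∈ S, G.Adj x c ∧ c ≠ m := by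
            by_cases hma : a = m
            · exact ⟨b, hb, hxb, fun h => hab (hma.trans h.symm)⟩
            · exact ⟨a, ha, hxa, hma⟩
          have hcq : c ∈ q.support := by
            have := hcon c hcS hxc
            rw [SimpleGraph.Walk.support_cons, List.mem_cons] at this
            exact this.resolve_left hxc.ne'
          have hsubq := q.support_takeUntil_subset_support hcq
          have huS : u ∉ S := fun hu => (hS u hu).ne rfl
          refine hG.no_wheel hcm.symm (hS m (hsup m (by simp))) (hS x (hsup x (by simp)))
            (hS c hcS) h.symm hxc (q.takeUntil c hcq) ?_ ?_
          · exact fun hu => huS (hsup u (by simpa using Or.inr (hsubq hu)))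
          · exact fun hx => hp.2 (hsubq hx)
      obtain ⟨c, hcS, hxc, hcp⟩ := hext
      refine ⟨c, y, .cons hxc.symm p, ?_, by simp [hlen], ?_⟩
      · exact (SimpleGraph.Walk.cons_isPath_iff _ _).2 ⟨hp, hcp⟩
      · intro v hv
        rw [SimpleGraph.Walk.support_cons, List.mem_cons] at hv
        rcases hv with rfl | hv
        · exact hcS
        · exact hsup v hv
  have := Fintype.ofFinite V
  obtain ⟨x, y, p, hp, hlen, -⟩ := key (Fintype.card V)
  exact hp.length_lt.ne hlen

-- A forest on `S` has at most `|S| - 1` edges; the induction removes a leaf.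
open scoped Classical in
theorem sum_card_neighbors_le_of_leaf {V : Type*} [Fintype V] {G : SimpleGraph V} (S : Finset V)
    (hS : S.Nonempty)
    (hleaf : ∀ T ⊆ S, T.Nonempty → ∃ x ∈ T, ∀ y ∈ T, ∀ z ∈ T, G.Adj x y → G.Adj x z → y = z) :
    ∑ x ∈ S, (G.neighborFinset x ∩ S).card + 2 ≤ 2 * S.card := by
  induction S using Finset.strongInduction with
  | H S ih =>
    obtain ⟨x, hx, hx1⟩ := hleaf S subset_rfl hS
    have hle : (G.neighborFinset x ∩ S).card ≤ 1 := by
      rw [Finset.card_le_one]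
      intro a ha b hb
      simp only [Finset.mem_inter, SimpleGraph.mem_neighborFinset] at ha hb
      exact hx1 a ha.2 b hb.2 ha.1 hb.1
    rcases (S.erase x).eq_empty_or_nonempty with he | hne
    · have hSx : S = {x} := by
        rw [← Finset.insert_erase hx, he]; rfl
      subst hSx
      have : G.neighborFinset x ∩ {x} = ∅ := by
        ext y; simp only [Finset.mem_inter, SimpleGraph.mem_neighborFinset, Finset.mem_singleton,
          Finset.notMem_empty, iff_false]
        rintro ⟨h, rfl⟩; exact h.ne rfl
      simp [this]
    · have hih := ih (S.erase x) (Finset.erase_ssubset hx) hne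
        (fun T hT => hleaf T (hT.trans (Finset.erase_subset _ _)))
      have hcard := Finset.card_erase_add_one hx
      rw [← Finset.add_sum_erase S _ hx]
      have hstep : ∀ y ∈ S.erase x, (G.neighborFinset y ∩ S).card =
          (G.neighborFinset y ∩ S.erase x).card + if G.Adj x y then 1 else 0 := by
        intro y hy
        rw [Finset.inter_erase]
        split_ifs with h
        · rw [Finset.card_erase_add_one (by simp [hx, h.symm])]
        · rw [Finset.erase_eq_of_notMem (by simp [G.adj_comm y x, h]), add_zero]
      rw [Finset.sum_congr rfl hstep, Finset.sum_add_distrib]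
      have : ∑ y ∈ S.erase x, (if G.Adj x y then 1 else 0) ≤ 1 := by
        rw [← Finset.card_filter]
        refine (Finset.card_le_card ?_).trans hle
        intro y hy
        simp only [Finset.mem_filter, Finset.mem_erase] at hy
        simp [hy]
      omega

-- The sum counts pairs of a vertex `x` and a common neighbour of `x` and `v`. With d the degree of
-- `v` and n the number of vertices, `v` itself contributes d, its neighbours at most 2d - 2 by the
-- forest bound, and each of the other n - 1 - d vertices at most 2.
open scoped Classical in
theorem IsOuterplanar.sum_degree_neighbors_le {V : Type*} [Fintype V] {G : SimpleGraph V}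
    (hG : IsOuterplanar G) {v : V} (hv : 1 ≤ G.degree v) :
    ∑ z ∈ G.neighborFinset v, G.degree z + 4 ≤ G.degree v + 2 * Fintype.card V := by
  have hdc : ∑ z ∈ G.neighborFinset v, G.degree z =
      ∑ x, (G.neighborFinset x ∩ G.neighborFinset v).card := by
    have h1 : ∀ z, G.degree z = ∑ x, if G.Adj z x then 1 else 0 := by
      intro z
      rw [← Finset.card_filter, ← SimpleGraph.card_neighborFinset_eq_degree]
      congr 1; ext; simp
    have h2 : ∀ x, (G.neighborFinset x ∩ G.neighborFinset v).card =
        ∑ z ∈ G.neighborFinset v, if G.Adj z x then 1 else 0 := by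
      intro x
      rw [← Finset.card_filter]
      congr 1; ext z; simp [G.adj_comm z x, and_comm]
    simp_rw [h1, h2]
    exact Finset.sum_comm
  have hnv : v ∉ G.neighborFinset v := by simp
  have hsplit : (Finset.univ : Finset V) =
      insert v (G.neighborFinset v ∪ (insert v (G.neighborFinset v))ᶜ) := by
    ext x; by_cases x = v <;> by_cases G.Adj v x <;> simp [*]
  have hcompl : ((insert v (G.neighborFinset v))ᶜ).card + G.degree v + 1 = Fintype.card V := by
    rw [← Finset.card_add_card_compl (insert v (G.neighborFinset v)), Finset.card_insert_of_notMem hnv,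
      SimpleGraph.card_neighborFinset_eq_degree]
    ring
  have hN : (G.neighborFinset v).Nonempty := by
    rw [← Finset.card_pos, SimpleGraph.card_neighborFinset_eq_degree]; exact hv
  have hsum1 := sum_card_neighbors_le_of_leaf (G := G) (G.neighborFinset v) hN
    (fun T hT hTne => hG.exists_leaf (u := v) (S := (T : Set V))
      (fun x hx => by simpa using hT hx) hTne)
  have hsum2 : ∑ x ∈ (insert v (G.neighborFinset v))ᶜ,
      (G.neighborFinset x ∩ G.neighborFinset v).card ≤
      (insert v (G.neighborFinset v))ᶜ.card * 2 := by
    refine Finset.sum_le_card_nsmul _ _ _ fun x hx => hG.card_common_neighbors_le ?_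
    rintro rfl; simp at hx
  rw [hdc, hsplit, Finset.sum_insert, Finset.sum_union]
  · rw [SimpleGraph.card_neighborFinset_eq_degree] at hsum1
    rw [Finset.inter_self, SimpleGraph.card_neighborFinset_eq_degree]
    omega
  · rw [Finset.disjoint_left]; intro x hx; simp at hx ⊢; exact fun _ => hx
  · simp

open scoped Classical in
theorem IsOuterplanar.degree_add_degree_le {V : Type*} [Fintype V] {G : SimpleGraph V}
    (hG : IsOuterplanar G) {a b : V} (hab : a ≠ b) :
    G.degree a + G.degree b ≤ Fintype.card V + 2 := by
  rw [← SimpleGraph.card_neighborFinset_eq_degree, ← SimpleGraph.card_neighborFinset_eq_degree,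
    ← Finset.card_union_add_card_inter]
  exact add_le_add (Finset.card_le_univ _) (hG.card_common_neighbors_le hab)

/-- A graph all of whose subsets of `S` contain a vertex of degree at most one, and whose degrees
within `S` are at most two, is a subgraph of a path there. -/
theorem exists_path_position {V : Type*} {G : SimpleGraph V} (S : Finset V)
    (hleaf : ∀ T ⊆ S, T.Nonempty → ∃ x ∈ T, ∀ y ∈ T, ∀ z ∈ T, G.Adj x y → G.Adj x z → y = z)
    (hdeg : ∀ x ∈ S, ∀ a ∈ S, ∀ b ∈ S, ∀ c ∈ S, G.Adj x a → G.Adj x b → G.Adj x c →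
      a = b ∨ a = c ∨ b = c) :
    ∃ f : V → ℤ, Set.InjOn f S ∧
      ∀ x ∈ S, ∀ y ∈ S, G.Adj x y → f y = f x + 1 ∨ f x = f y + 1 := by
  classical
  induction S using Finset.strongInduction with
  | H S ih =>
    rcases S.eq_empty_or_nonempty with rfl | hS
    · exact ⟨0, by simp, by simp⟩
    obtain ⟨x, hx, hx1⟩ := hleaf S subset_rfl hS
    have hsub := Finset.erase_subset x S
    obtain ⟨f, hf, hadj⟩ := ih (S.erase x) (Finset.erase_ssubset hx)
      (fun T hT => hleaf T (hT.trans hsub))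
      (fun v hv a ha b hb c hc => hdeg v (hsub hv) a (hsub ha) b (hsub hb) c (hsub hc))
    by_cases hiso : ∃ y ∈ S, G.Adj x y
    · obtain ⟨y, hy, hxy⟩ := hiso
      have hyx : y ≠ x := hxy.ne'
      -- Besides the leaf `x`, its neighbour `y` has at most one neighbour. After a reflection, if
      -- needed, that one is not to the right of `y`.
      obtain ⟨g, hg, hgadj, hgy⟩ : ∃ g : V → ℤ, Set.InjOn g (S.erase x) ∧
          (∀ a ∈ S.erase x, ∀ b ∈ S.erase x, G.Adj a b → g b = g a + 1 ∨ g a = g b + 1) ∧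
          ∀ z ∈ S.erase x, G.Adj y z → g z ≠ g y + 1 := by
        by_cases hz : ∃ z ∈ S.erase x, G.Adj y z ∧ f z = f y + 1
        · obtain ⟨z, hz, hyz, hfz⟩ := hz
          refine ⟨fun v => -f v, fun a ha b hb hab => hf ha hb (neg_injective hab),
            fun a ha b hb hab => ?_, fun z' hz' hyz' hfz' => ?_⟩
          · rcases hadj a ha b hb hab with h | h
            · right; linarith
            · left; linarith
          · have hzx := Finset.ne_of_mem_erase hz
            have hzx' := Finset.ne_of_mem_erase hz'
            rcases hdeg y hy z (hsub hz) z' (hsub hz') x hx hyz hyz' hxy.symm with h | h | h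
            · subst h; linarith
            · exact hzx h
            · exact hzx' h
        · push Not at hz
          exact ⟨f, hf, hadj, hz⟩
      have hyS : y ∈ S.erase x := Finset.mem_erase.2 ⟨hyx, hy⟩
      -- Everything to the right of `y` moves one place to make room for `x`. No edge is stretched,
      -- since none joins `y` to the next position.
      refine ⟨fun v => if v = x then g y + 1 else if g v ≤ g y then g v else g v + 1, ?_, ?_⟩
      · intro a ha b hb hab
        simp only at hab
        by_cases hax : a = x <;> by_cases hbx : b = x
        · rw [hax, hbx]
        · simp only [hax, hbx, if_true, if_false] at hab
          split_ifs at hab <;> omega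
        · simp only [hax, hbx, if_true, if_false] at hab
          split_ifs at hab <;> omega
        · simp only [hax, hbx, if_false] at hab
          refine hg (Finset.mem_erase.2 ⟨hax, ha⟩) (Finset.mem_erase.2 ⟨hbx, hb⟩) ?_
          split_ifs at hab <;> omega
      · have hnb : ∀ b ∈ S, G.Adj x b → b = y := fun b hb h => hx1 b hb y hy h hxy
        intro a ha b hb hab
        by_cases hax : a = x
        · subst hax
          rw [hnb b hb hab]
          simp [hyx]
        by_cases hbx : b = x
        · subst hbx
          rw [hnb a ha hab.symm]
          simp [hyx]
        have ha' : a ∈ S.erase x := Finset.mem_erase.2 ⟨hax, ha⟩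
        have hb' : b ∈ S.erase x := Finset.mem_erase.2 ⟨hbx, hb⟩
        have hay : g a = g y → g b ≠ g y + 1 := fun h => by
          have := hg ha' hyS h
          subst this; exact hgy b hb' hab
        have hby : g b = g y → g a ≠ g y + 1 := fun h => by
          have := hg hb' hyS h
          subst this; exact hgy a ha' hab.symm
        have := hgadj a ha' b hb' hab
        simp only [hax, hbx, if_false]
        split_ifs <;> omega
    · push Not at hiso
      obtain ⟨M, hM⟩ := Infinite.exists_notMem_finset ((S.erase x).image f)
      have hM' : ∀ v ∈ S, v ≠ x → f v ≠ M := fun v hv hvx h =>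
        hM (Finset.mem_image.2 ⟨v, Finset.mem_erase.2 ⟨hvx, hv⟩, h⟩)
      refine ⟨Function.update f x M, ?_, ?_⟩
      · intro a ha b hb hab
        by_cases hax : a = x <;> by_cases hbx : b = x
        · rw [hax, hbx]
        · subst hax; simp [hbx] at hab; exact absurd hab.symm (hM' b hb hbx)
        · subst hbx; simp [hax] at hab; exact absurd hab (hM' a ha hax)
        · simp [hax, hbx] at hab
          exact hf (Finset.mem_erase.2 ⟨hax, ha⟩) (Finset.mem_erase.2 ⟨hbx, hb⟩) hab
      · intro a ha b hb hab
        have hax : a ≠ x := by rintro rfl; exact hiso b hb hab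
        have hbx : b ≠ x := by rintro rfl; exact hiso a ha hab.symm
        simpa [hax, hbx] using hadj a (Finset.mem_erase.2 ⟨hax, ha⟩) b
          (Finset.mem_erase.2 ⟨hbx, hb⟩) hab

end Counting

/-! ### The Q-index: Rayleigh quotients and eigenvectors -/

section Spectral

open Matrix

variable {V : Type*} [Fintype V] (G : SimpleGraph V)

open scoped Classical in
theorem signlessLaplacian_mulVec (x : V → ℝ) (i : V) :
    (signlessLaplacian G *ᵥ x) i = G.degree i * x i + ∑ j ∈ G.neighborFinset i, x j := by
  rw [signlessLaplacian, add_mulVec, Pi.add_apply, SimpleGraph.adjMatrix_mulVec_apply,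
    SimpleGraph.degMatrix, mulVec_diagonal]

theorem isHermitian_signlessLaplacian : (signlessLaplacian G).IsHermitian := by
  classical
  ext i j
  simp [signlessLaplacian, SimpleGraph.degMatrix, diagonal_apply, G.adj_comm i j, eq_comm (a := i)]
  split_ifs with h
  · rw [h]
  · rfl

open scoped Classical in
theorem finite_setOf_hasEigenvalue_signlessLaplacian :
    {μ : ℝ | Module.End.HasEigenvalue (Matrix.toLin' (signlessLaplacian G)) μ}.Finite :=
  Module.End.finite_hasEigenvalue _

open scoped Classical in
theorem le_qIndex {x : V → ℝ} (hx : x ≠ 0) {μ : ℝ} (h : signlessLaplacian G *ᵥ x = μ • x) :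
    μ ≤ qIndex G := by
  refine le_csSup (finite_setOf_hasEigenvalue_signlessLaplacian G).bddAbove ?_
  refine Module.End.hasEigenvalue_of_hasEigenvector (x := x) ⟨?_, hx⟩
  rw [Module.End.mem_eigenspace_iff, toLin'_apply, h]

-- An eigenvalue ν of the difference yields the eigenvalue `qIndex G - ν` of `Q`, which cannot
-- exceed `qIndex G`.
open scoped Classical in
theorem posSemidef_qIndex_sub :
    (qIndex G • (1 : Matrix V V ℝ) - signlessLaplacian G).PosSemidef := by
  have hQ := isHermitian_signlessLaplacian G
  have hH : (qIndex G • (1 : Matrix V V ℝ) - signlessLaplacian G).IsHermitian := by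
    refine IsHermitian.sub ?_ hQ
    ext i j
    simp [one_apply, eq_comm (a := i)]
  rw [hH.posSemidef_iff_eigenvalues_nonneg]
  intro i
  have h1 := hH.mulVec_eigenvectorBasis i
  set y : V → ℝ := (hH.eigenvectorBasis i).ofLp with hy
  have hy0 : y ≠ 0 := by
    intro h
    refine hH.eigenvectorBasis.orthonormal.ne_zero i ?_
    ext j; exact congrFun h j
  have h2 : signlessLaplacian G *ᵥ y = (qIndex G - hH.eigenvalues i) • y := by
    rw [sub_mulVec, smul_mulVec, one_mulVec] at h1
    rw [sub_smul, ← h1]; simp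
  have := le_qIndex G hy0 h2
  simp only [Pi.zero_apply]
  linarith

theorem dotProduct_signlessLaplacian_le (y : V → ℝ) :
    y ⬝ᵥ (signlessLaplacian G *ᵥ y) ≤ qIndex G * (y ⬝ᵥ y) := by
  classical
  have := (posSemidef_qIndex_sub G).dotProduct_mulVec_nonneg y
  rw [sub_mulVec, smul_mulVec, one_mulVec, star_trivial, dotProduct_sub, dotProduct_smul,
    smul_eq_mul] at this
  linarith

open scoped Classical in
theorem hasEigenvalue_qIndex [Nonempty V] :
    Module.End.HasEigenvalue (Matrix.toLin' (signlessLaplacian G)) (qIndex G) := by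
  have hne : {μ : ℝ | Module.End.HasEigenvalue (Matrix.toLin' (signlessLaplacian G)) μ}.Nonempty := by
    obtain ⟨i⟩ := ‹Nonempty V›
    have hQ := isHermitian_signlessLaplacian G
    refine ⟨hQ.eigenvalues i, Module.End.hasEigenvalue_of_hasEigenvector
      (x := (hQ.eigenvectorBasis i).ofLp) ⟨?_, fun h => ?_⟩⟩
    · rw [Module.End.mem_eigenspace_iff, toLin'_apply, hQ.mulVec_eigenvectorBasis]
    · refine hQ.eigenvectorBasis.orthonormal.ne_zero i ?_
      ext j; exact congrFun h j
  exact hne.csSup_mem (finite_setOf_hasEigenvalue_signlessLaplacian G)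

open scoped Classical in
theorem exists_mulVec_eq_qIndex_smul [Nonempty V] :
    ∃ x : V → ℝ, x ≠ 0 ∧ signlessLaplacian G *ᵥ x = qIndex G • x := by
  obtain ⟨x, hx⟩ := (hasEigenvalue_qIndex G).exists_hasEigenvector
  refine ⟨x, hx.2, ?_⟩
  rw [← toLin'_apply]
  exact hx.apply_eq_smul

/-- The `Q`-index has a nonnegative eigenvector. -/
theorem exists_nonneg_eigenvector [Nonempty V] :
    ∃ x : V → ℝ, x ≠ 0 ∧ (∀ i, 0 ≤ x i) ∧ signlessLaplacian G *ᵥ x = qIndex G • x := by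
  classical
  obtain ⟨x, hx0, hx⟩ := exists_mulVec_eq_qIndex_smul G
  refine ⟨fun i => |x i|, fun h => hx0 (funext fun i => abs_eq_zero.1 (congrFun h i)),
    fun i => abs_nonneg _, ?_⟩
  have hps := posSemidef_qIndex_sub G
  -- Taking absolute values does not decrease the quadratic form of `Q`, so `|x|` is a zero of a
  -- positive semidefinite form and therefore lies in its kernel.
  have h0 : star (fun i => |x i|) ⬝ᵥ
      ((qIndex G • (1 : Matrix V V ℝ) - signlessLaplacian G) *ᵥ fun i => |x i|) = 0 := by
    refine le_antisymm ?_ (hps.dotProduct_mulVec_nonneg _)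
    rw [sub_mulVec, smul_mulVec, one_mulVec, star_trivial, dotProduct_sub, dotProduct_smul,
      smul_eq_mul, sub_nonpos]
    have h1 : x ⬝ᵥ (signlessLaplacian G *ᵥ x) = qIndex G * (x ⬝ᵥ x) := by
      rw [hx, dotProduct_smul, smul_eq_mul]
    have h2 : (fun i => |x i|) ⬝ᵥ (fun i => |x i|) = x ⬝ᵥ x := by
      simp [dotProduct]
    rw [h2, ← h1]
    simp only [dotProduct]
    refine Finset.sum_le_sum fun i _ => ?_
    rw [signlessLaplacian_mulVec, signlessLaplacian_mulVec, mul_add, mul_add]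
    refine add_le_add (le_of_eq ?_) ?_
    · rw [mul_left_comm, mul_left_comm |x i|, abs_mul_abs_self]
    · rw [Finset.mul_sum, Finset.mul_sum]
      refine Finset.sum_le_sum fun j _ => ?_
      rw [← abs_mul]; exact le_abs_self _
  have h3 := (hps.dotProduct_mulVec_zero_iff _).1 h0
  rw [sub_mulVec, smul_mulVec, one_mulVec, sub_eq_zero] at h3
  exact h3.symm

open scoped Classical in
/-- A positive vector whose images under `Q` are everywhere less than `r` times it certifies that
the `Q`-index is less than `r`. -/
theorem qIndex_lt_of_row_bound [Nonempty V] {y : V → ℝ} (hy : ∀ i, 0 < y i) {r : ℝ}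
    (h : ∀ i, G.degree i * y i + ∑ j ∈ G.neighborFinset i, y j < r * y i) : qIndex G < r := by
  obtain ⟨x, hx0, hxn, hx⟩ := exists_nonneg_eigenvector G
  -- The eigenvector is compared with `y` at the index where their ratio is largest.
  obtain ⟨i, -, hi⟩ := Finset.exists_max_image Finset.univ (fun i => x i / y i)
    Finset.univ_nonempty
  have hle : ∀ j, x j ≤ x i / y i * y j := fun j => by
    have := hi j (Finset.mem_univ j)
    rwa [div_le_iff₀ (hy j)] at this
  have hxi : 0 < x i := by
    refine (hxn i).lt_of_ne fun h0 => hx0 (funext fun j => ?_)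
    have := hle j
    rw [← h0, zero_div, zero_mul] at this
    exact le_antisymm this (hxn j)
  have hrow := congrFun hx i
  rw [signlessLaplacian_mulVec, Pi.smul_apply, smul_eq_mul] at hrow
  have h1 : ∑ j ∈ G.neighborFinset i, x j ≤ x i / y i * ∑ j ∈ G.neighborFinset i, y j := by
    rw [Finset.mul_sum]; exact Finset.sum_le_sum fun j _ => hle j
  have hc : 0 < x i / y i := div_pos hxi (hy i)
  have h2 := mul_lt_mul_of_pos_left (h i) hc
  have h3 : x i / y i * y i = x i := div_mul_cancel₀ _ (hy i).ne'
  have h4 : qIndex G * x i < r * x i := by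
    calc qIndex G * x i = G.degree i * x i + ∑ j ∈ G.neighborFinset i, x j := hrow.symm
      _ ≤ G.degree i * (x i / y i * y i) + x i / y i * ∑ j ∈ G.neighborFinset i, y j := by
        rw [h3]; linarith
      _ = x i / y i * (G.degree i * y i + ∑ j ∈ G.neighborFinset i, y j) := by ring
      _ < x i / y i * (r * y i) := h2
      _ = r * (x i / y i * y i) := by ring
      _ = r * x i := by rw [h3]
  exact lt_of_mul_lt_mul_right h4 hxi.le

open scoped Classical in
/-- The `Q`-index of a graph with a vertex adjacent to all others and no further edges. -/
theorem card_le_qIndex_star {u : V} (h1 : 1 < Fintype.card V)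
    (hG : ∀ a b, G.Adj a b ↔ a ≠ b ∧ (a = u ∨ b = u)) :
    (Fintype.card V : ℝ) ≤ qIndex G := by
  have hcard : 1 ≤ Fintype.card V := h1.le
  have hN : G.neighborFinset u = Finset.univ.erase u := by
    ext a; simp [hG, eq_comm]
  have hN' : ∀ v, v ≠ u → G.neighborFinset v = {u} := by
    intro v hv; ext a
    simp only [SimpleGraph.mem_neighborFinset, hG, Finset.mem_singleton]
    constructor
    · rintro ⟨-, h | h⟩
      · exact absurd h hv
      · exact h
    · rintro rfl; exact ⟨hv, Or.inr rfl⟩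
  have hd : (G.degree u : ℝ) = Fintype.card V - 1 := by
    rw [← SimpleGraph.card_neighborFinset_eq_degree, hN, Finset.card_erase_of_mem (Finset.mem_univ u),
      Finset.card_univ, Nat.cast_sub hcard, Nat.cast_one]
  refine le_qIndex G (x := fun v => if v = u then (Fintype.card V : ℝ) - 1 else 1) ?_ ?_
  · intro h
    have := congrFun h u
    simp only [if_true, Pi.zero_apply] at this
    have : (1 : ℝ) < Fintype.card V := by exact_mod_cast h1
    linarith
  · ext v
    rw [signlessLaplacian_mulVec, Pi.smul_apply, smul_eq_mul]
    by_cases hv : v = u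
    · subst hv
      rw [hN, Finset.sum_congr rfl (g := fun _ => (1 : ℝ))
        (fun j hj => if_neg (Finset.ne_of_mem_erase hj)), hd, Finset.sum_const,
        Finset.card_erase_of_mem (Finset.mem_univ v), Finset.card_univ, nsmul_eq_mul,
        Nat.cast_sub hcard]
      simp
      ring
    · rw [← SimpleGraph.card_neighborFinset_eq_degree, hN' v hv]
      simp [hv]

open scoped Classical in
theorem two_mul_dotProduct_signlessLaplacian (x : V → ℝ) :
    2 * (x ⬝ᵥ (signlessLaplacian G *ᵥ x)) =
      ∑ i, ∑ j, if G.Adj i j then (x i + x j) ^ 2 else 0 := by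
  have hN : ∀ i (g : V → ℝ), ∑ j ∈ G.neighborFinset i, g j = ∑ j, if G.Adj i j then g j else 0 := by
    intro i g
    rw [← Finset.sum_filter]; congr 1; ext; simp
  have hd : ∀ i, (G.degree i : ℝ) = ∑ j, if G.Adj i j then 1 else 0 := by
    intro i
    rw [← hN i (fun _ => 1)]; simp
  have h1 : x ⬝ᵥ (signlessLaplacian G *ᵥ x) =
      ∑ i, ∑ j, if G.Adj i j then (x i ^ 2 + x i * x j) else 0 := by
    simp only [dotProduct]
    refine Finset.sum_congr rfl fun i _ => ?_
    rw [signlessLaplacian_mulVec, hN, hd, mul_add, Finset.sum_mul, Finset.mul_sum, Finset.mul_sum,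
      ← Finset.sum_add_distrib]
    refine Finset.sum_congr rfl fun j _ => ?_
    split_ifs <;> ring
  have h2 : x ⬝ᵥ (signlessLaplacian G *ᵥ x) =
      ∑ i, ∑ j, if G.Adj i j then (x j ^ 2 + x i * x j) else 0 := by
    rw [h1, Finset.sum_comm]
    refine Finset.sum_congr rfl fun i _ => Finset.sum_congr rfl fun j _ => ?_
    rw [G.adj_comm, mul_comm]
  rw [two_mul]
  nth_rewrite 1 [h1]
  rw [h2, ← Finset.sum_add_distrib]
  refine Finset.sum_congr rfl fun i _ => ?_
  rw [← Finset.sum_add_distrib]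
  refine Finset.sum_congr rfl fun j _ => ?_
  split_ifs <;> ring

end Spectral

/-! ### Pendant moves and the extremal graph -/

section Extremal

open Matrix

variable {V : Type*}

/-- Remove all edges at `w` and make it a pendant vertex at `u`. -/
def movePendant (G : SimpleGraph V) (u w : V) : SimpleGraph V where
  Adj a b := (G.Adj a b ∧ a ≠ w ∧ b ≠ w) ∨ (a ≠ b ∧ ((a = w ∧ b = u) ∨ (a = u ∧ b = w)))
  symm := ⟨fun a b h => by
    rcases h with ⟨h, ha, hb⟩ | ⟨h, h' | h'⟩
    · exact Or.inl ⟨h.symm, hb, ha⟩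
    · exact Or.inr ⟨h.symm, Or.inr ⟨h'.2, h'.1⟩⟩
    · exact Or.inr ⟨h.symm, Or.inl ⟨h'.2, h'.1⟩⟩⟩
  loopless := ⟨fun a h => by
    rcases h with ⟨h, -⟩ | ⟨h, -⟩
    · exact h.ne rfl
    · exact h rfl⟩

theorem movePendant_adj_of_ne {G : SimpleGraph V} {u w a b : V} (ha : a ≠ w) (hb : b ≠ w) :
    (movePendant G u w).Adj a b ↔ G.Adj a b := by
  simp [movePendant, ha, hb]

theorem movePendant_adj_pendant {G : SimpleGraph V} {u w b : V} (huw : u ≠ w) :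
    (movePendant G u w).Adj w b ↔ b = u := by
  simp only [movePendant]
  grind

theorem connected_of_forall_adj {H : SimpleGraph V} {u : V} (h : ∀ v, v ≠ u → H.Adj u v) :
    H.Connected := by
  have hr : ∀ v, H.Reachable u v := fun v => by
    by_cases hv : v = u
    · rw [hv]
    · exact (h v hv).reachable
  exact { preconnected := fun a b => (hr a).symm.trans (hr b), nonempty := ⟨u⟩ }

theorem free_of_two_disjoint_edges {W : Type*} {F : SimpleGraph W} {H : SimpleGraph V} {u : V}
    (hH : ∀ a b, H.Adj a b → a = u ∨ b = u) {p q r s : W} (hpq : F.Adj p q) (hrs : F.Adj r s)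
    (hpr : p ≠ r) (hps : p ≠ s) (hqr : q ≠ r) (hqs : q ≠ s) : F.Free H := by
  rintro ⟨φ⟩
  have hinj := φ.injective
  rcases hH _ _ (φ.toHom.map_adj hpq) with h1 | h1 <;>
    rcases hH _ _ (φ.toHom.map_adj hrs) with h2 | h2
  · exact hpr (hinj (h1.trans h2.symm))
  · exact hps (hinj (h1.trans h2.symm))
  · exact hqr (hinj (h1.trans h2.symm))
  · exact hqs (hinj (h1.trans h2.symm))

/-- A copy of `F` cannot use the pendant vertex, so it already lies in `G`. -/
theorem free_movePendant_of_two_neighbors {W : Type*} {F : SimpleGraph W} {G : SimpleGraph V}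
    {u w : V} (huw : u ≠ w) (hF : ∀ p, ∃ a b, a ≠ b ∧ F.Adj p a ∧ F.Adj p b) (hG : F.Free G) :
    F.Free (movePendant G u w) := by
  rintro ⟨φ⟩
  have hw : ∀ p, φ p ≠ w := by
    intro p hp
    obtain ⟨a, b, hab, ha, hb⟩ := hF p
    have h1 := φ.toHom.map_adj ha
    have h2 := φ.toHom.map_adj hb
    change (movePendant G u w).Adj (φ p) (φ a) at h1
    change (movePendant G u w).Adj (φ p) (φ b) at h2
    rw [hp, movePendant_adj_pendant huw] at h1 h2
    exact hab (φ.injective (h1.trans h2.symm))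
  exact hG ⟨⟨⟨φ, fun {a b} h => (movePendant_adj_of_ne (hw a) (hw b)).1 (φ.toHom.map_adj h)⟩,
    φ.injective⟩⟩

/-- A copy of `F` through the pendant vertex `w` misses some vertex `z`. In the copy `w` is joined
only to `u`, so `z`, a neighbour of `u` in `G`, can take its place. -/
theorem free_movePendant_of_card_lt {W : Type*} [Fintype W] [Fintype V] {F : SimpleGraph W}
    {G : SimpleGraph V} {u w : V} (huw : u ≠ w) (hu : ∀ v, v ≠ u → v ≠ w → G.Adj u v)
    (hF : ∀ p, ∃ a, F.Adj p a) (hcard : Fintype.card W < Fintype.card V) (hG : F.Free G) :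
    F.Free (movePendant G u w) := by
  classical
  rintro ⟨φ⟩
  have hadj : ∀ {a b}, F.Adj a b → (movePendant G u w).Adj (φ a) (φ b) :=
    fun h => φ.toHom.map_adj h
  by_cases hw : ∃ p, φ p = w
  · obtain ⟨p, hp⟩ := hw
    have hpn : ∀ a, F.Adj p a → φ a = u := fun a ha => by
      have := hadj ha
      rwa [hp, movePendant_adj_pendant huw] at this
    obtain ⟨c, hc⟩ := hF p
    have hcu := hpn c hc
    obtain ⟨z, hz⟩ : ∃ z, ∀ a, φ a ≠ z := by
      by_contra! hsurj
      exact hcard.not_ge (Fintype.card_le_of_surjective φ hsurj)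
    have hzu : z ≠ u := fun h => hz c (hcu.trans h.symm)
    have hzw : z ≠ w := fun h => hz p (hp.trans h.symm)
    have hne : ∀ a, a ≠ p → φ a ≠ w := fun a ha h => ha (φ.injective (h.trans hp.symm))
    refine hG ⟨⟨⟨fun a => if a = p then z else φ a, fun {a b} h => ?_⟩, fun a b hab => ?_⟩⟩
    · by_cases ha : a = p <;> by_cases hb : b = p
      · exact absurd (ha.trans hb.symm) h.ne
      · subst ha
        simp only [hb, if_true, if_false]
        rw [hpn b h]
        exact (hu z hzu hzw).symm
      · subst hb
        simp only [ha, if_true, if_false]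
        rw [hpn a h.symm]
        exact hu z hzu hzw
      · simp only [ha, hb, if_false]
        exact (movePendant_adj_of_ne (hne a ha) (hne b hb)).1 (hadj h)
    · change (if a = p then z else φ a) = (if b = p then z else φ b) at hab
      split_ifs at hab with h1 h2 h2
      · rw [h1, h2]
      · exact absurd hab.symm (hz b)
      · exact absurd hab (hz a)
      · exact φ.injective hab
  · push Not at hw
    exact hG ⟨⟨⟨φ, fun {a b} h => (movePendant_adj_of_ne (hw a) (hw b)).1 (hadj h)⟩,
      φ.injective⟩⟩

section

variable [Fintype V] {G : SimpleGraph V}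

theorem isOuterplanar_of_edges_at_vertex {H : SimpleGraph V} {u : V}
    (hH : ∀ a b, H.Adj a b → a = u ∨ b = u) : IsOuterplanar H := by
  refine isOuterplanar_of_fan (u := u) (f := fun v => ((Fintype.equivFin V v : ℕ) : ℤ)) H ?_ ?_
  · intro a _ b _ hab
    have hab' : ((Fintype.equivFin V a : ℕ) : ℤ) = (Fintype.equivFin V b : ℕ) := hab
    exact (Fintype.equivFin V).injective (Fin.ext (by exact_mod_cast hab'))
  · intro a b h ha hb
    exact ((hH a b h).elim ha hb).elim

/-- The neighbourhood of `u` induces a forest with degrees at most two, hence a linear forest. With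
`w` at an unused position, the new graph is a fan with hub `u`. -/
theorem IsOuterplanar.movePendant (hG : IsOuterplanar G) {u w : V} (huw : u ≠ w)
    (hu : ∀ v, v ≠ u → v ≠ w → G.Adj u v) : IsOuterplanar (movePendant G u w) := by
  classical
  obtain ⟨f, hf, hadj⟩ := exists_path_position (G := G) (G.neighborFinset u)
    (fun T hT hTne => hG.exists_leaf (u := u) (S := (T : Set V))
      (fun x hx => by simpa using hT hx) hTne) (by
      intro x hx a ha b hb c hc hxa hxb hxc
      by_contra! hne
      rw [SimpleGraph.mem_neighborFinset] at hx ha hb hc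
      refine (hG.card_common_neighbors_le hx.ne).not_gt (Finset.two_lt_card_iff.2
        ⟨a, b, c, ?_, ?_, ?_, hne.1, hne.2.1, hne.2.2⟩) <;> simp [*])
  obtain ⟨M, hM⟩ := Infinite.exists_notMem_finset ((G.neighborFinset u).image f)
  have hM' : ∀ v, v ≠ u → v ≠ w → f v ≠ M := fun v h1 h2 h =>
    hM (Finset.mem_image.2 ⟨v, by simpa using hu v h1 h2, h⟩)
  refine isOuterplanar_of_fan (u := u) (f := Function.update f w M) _ ?_ ?_
  · intro a ha b hb hab
    by_cases haw : a = w <;> by_cases hbw : b = w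
    · rw [haw, hbw]
    · subst haw; simp [hbw] at hab; exact absurd hab.symm (hM' b hb hbw)
    · subst hbw; simp [haw] at hab; exact absurd hab (hM' a ha haw)
    · simp [haw, hbw] at hab
      exact hf (by simpa using hu a ha haw) (by simpa using hu b hb hbw) hab
  · intro a b h ha hb
    have haw : a ≠ w := by
      rintro rfl; exact hb ((movePendant_adj_pendant huw).1 h)
    have hbw : b ≠ w := by
      rintro rfl; exact ha ((movePendant_adj_pendant huw).1 h.symm)
    rw [movePendant_adj_of_ne haw hbw] at h
    simpa [haw, hbw] using hadj a (by simpa using hu a ha haw) b (by simpa using hu b hb hbw) h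

open scoped Classical in
theorem IsOuterplanar.qIndex_lt_card (hG : IsOuterplanar G) (hconn : G.Connected)
    (hn : 9 ≤ Fintype.card V) (hdeg : ∀ v, G.degree v + 3 ≤ Fintype.card V) :
    qIndex G < Fintype.card V := by
  have := hconn.nonempty
  have : Nontrivial V := Fintype.one_lt_card_iff_nontrivial.1 (by omega)
  have hpos : ∀ v, 1 ≤ G.degree v := fun v => hconn.preconnected.degree_pos_of_nontrivial v
  obtain ⟨u, -, hu⟩ := Finset.exists_max_image Finset.univ (fun v => G.degree v)
    Finset.univ_nonempty
  replace hu : ∀ v, G.degree v ≤ G.degree u := fun v => hu v (Finset.mem_univ v)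
  set n := Fintype.card V with hn_def
  have hnR : (9 : ℝ) ≤ n := by exact_mod_cast hn
  -- Plain degrees can fail in the row of `u`. With an extra weight c there, the estimates below
  -- need 3c > 2 in that row, and 8 + c < n in the rows of other vertices of degree at least 3; 3/4
  -- meets both for n ≥ 9.
  refine qIndex_lt_of_row_bound G (y := fun v => (G.degree v : ℝ) + if v = u then 3 / 4 else 0)
    (fun v => ?_) (fun v => ?_)
  · have : (1 : ℝ) ≤ G.degree v := by exact_mod_cast hpos v
    split_ifs <;> linarith
  have hd1 : (1 : ℝ) ≤ G.degree v := by exact_mod_cast hpos v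
  have hsum : (∑ z ∈ G.neighborFinset v, (G.degree z : ℝ)) + 4 ≤ G.degree v + 2 * n := by
    exact_mod_cast hG.sum_degree_neighbors_le (hpos v)
  have hdn : (G.degree v : ℝ) + 3 ≤ n := by exact_mod_cast hdeg v
  have hextra : ∑ z ∈ G.neighborFinset v, (if z = u then (3 / 4 : ℝ) else 0) ≤
      if v = u then 0 else 3 / 4 := by
    rw [Finset.sum_ite_eq']
    split_ifs with h1 h2 h2
    · subst h2; simp at h1
    · exact le_rfl
    · exact le_rfl
    · norm_num
  rw [Finset.sum_add_distrib]
  set d : ℝ := (G.degree v : ℝ) with hd_def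
  set s := ∑ z ∈ G.neighborFinset v, (G.degree z : ℝ) with hs_def
  rcases (hpos v).eq_or_lt with h1 | h1
  · -- a single neighbour
    have hs : s + 3 ≤ n := by
      obtain ⟨a, ha⟩ := Finset.card_eq_one.1
        ((SimpleGraph.card_neighborFinset_eq_degree G v).trans h1.symm)
      rw [hs_def, ha, Finset.sum_singleton]
      exact_mod_cast hdeg a
    have hd : d = 1 := by rw [hd_def, ← h1]; norm_num
    rw [hd]
    split_ifs at hextra ⊢ <;> linarith
  by_cases hv : v = u
  · simp only [hv, if_true] at hextra ⊢
    have hd2 : (2 : ℝ) ≤ d := by rw [hd_def]; exact_mod_cast h1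
    nlinarith [mul_nonneg (sub_nonneg.2 hd2) (sub_nonneg.2 hdn)]
  simp only [hv, if_false] at hextra ⊢
  rcases (Nat.succ_le_of_lt h1).eq_or_lt with h2 | h2
  -- For degree 2 the general bound on `s` is too weak; the two neighbours have at most two common
  -- neighbours.
  · have hs : s ≤ n + 2 := by
      obtain ⟨a, b, hab, hN⟩ := Finset.card_eq_two.1
        ((SimpleGraph.card_neighborFinset_eq_degree G v).trans h2.symm)
      rw [hs_def, hN, Finset.sum_pair hab]
      exact_mod_cast hG.degree_add_degree_le hab
    have hd : d = 2 := by rw [hd_def, ← h2]; norm_num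
    rw [hd]
    linarith
  · have hd3 : (3 : ℝ) ≤ d := by rw [hd_def]; exact_mod_cast h2
    -- `u` has maximum degree and the two degrees sum to at most n + 2, so `v` has degree at most (n
    -- + 2)/2.
    have hd4 : d + 4 ≤ n := by
      have h3 := hG.degree_add_degree_le hv
      have h4 := hu v
      have h5 : G.degree v + 4 ≤ n := by omega
      rw [hd_def]; exact_mod_cast h5
    nlinarith [mul_nonneg (sub_nonneg.2 hd3) (sub_nonneg.2 hd4)]

theorem sum_sum_eq_of_support_at (t : V → V → ℝ) (w : V) (hsymm : ∀ i j, t i j = t j i)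
    (hww : t w w = 0) (h0 : ∀ i j, i ≠ w → j ≠ w → t i j = 0) :
    ∑ i, ∑ j, t i j = 2 * ∑ j, t w j := by
  classical
  have h1 : ∀ i ∈ Finset.univ.erase w, ∑ j, t i j = t w i := by
    intro i hi
    rw [Finset.sum_eq_single w (fun j _ hj => h0 i j (Finset.ne_of_mem_erase hi) hj) (by simp),
      hsymm]
  rw [← Finset.add_sum_erase _ _ (Finset.mem_univ w), Finset.sum_congr rfl h1,
    ← Finset.add_sum_erase _ (fun j => t w j) (Finset.mem_univ w), hww]
  ring

-- The quadratic form is the sum of `(x i + x j)²` over the edges. The hypothesis says that the move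
-- increases it at the eigenvector of `G`.
open scoped Classical in
theorem qIndex_lt_qIndex_movePendant {u w : V} (huw : u ≠ w) {x : V → ℝ}
    (hx : signlessLaplacian G *ᵥ x = qIndex G • x)
    (hlt : ∑ j ∈ G.neighborFinset w, (x w + x j) ^ 2 < (x w + x u) ^ 2) :
    qIndex G < qIndex (movePendant G u w) := by
  have h1 := two_mul_dotProduct_signlessLaplacian G x
  have h2 := two_mul_dotProduct_signlessLaplacian (movePendant G u w) x
  have h3 : (∑ i, ∑ j, if (movePendant G u w).Adj i j then (x i + x j) ^ 2 else 0) -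
      (∑ i, ∑ j, if G.Adj i j then (x i + x j) ^ 2 else 0) =
      2 * ((x w + x u) ^ 2 - ∑ j ∈ G.neighborFinset w, (x w + x j) ^ 2) := by
    rw [← Finset.sum_sub_distrib]
    simp_rw [← Finset.sum_sub_distrib]
    rw [sum_sum_eq_of_support_at _ w]
    · rw [Finset.sum_sub_distrib]
      congr 2
      · simp only [movePendant_adj_pendant huw]
        simp
      · rw [← Finset.sum_filter]; congr 1; ext; simp
    · intro i j
      rw [SimpleGraph.adj_comm, G.adj_comm, add_comm]
    · simp
    · intro i j hi hj
      simp only [movePendant_adj_of_ne hi hj, sub_self]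
  have h4 := dotProduct_signlessLaplacian_le (movePendant G u w) x
  have h5 : x ⬝ᵥ (signlessLaplacian G *ᵥ x) = qIndex G * (x ⬝ᵥ x) := by
    rw [hx, dotProduct_smul, smul_eq_mul]
  have h6 : 0 ≤ x ⬝ᵥ x := by
    rw [dotProduct]; exact Finset.sum_nonneg fun i _ => mul_self_nonneg _
  have h7 : qIndex G * (x ⬝ᵥ x) < qIndex (movePendant G u w) * (x ⬝ᵥ x) := by linarith
  exact lt_of_mul_lt_mul_right h7 h6

open scoped Classical in
theorem IsOuterplanar.qIndex_lt_qIndex_movePendant (hG : IsOuterplanar G)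
    (hn : 9 ≤ Fintype.card V) {u w : V} (huw : u ≠ w) (hnadj : ¬ G.Adj w u)
    (hu : ∀ v, v ≠ u → v ≠ w → G.Adj u v) (hq : (Fintype.card V : ℝ) ≤ qIndex G) :
    qIndex G < qIndex (_root_.movePendant G u w) := by
  have : Nonempty V := ⟨u⟩
  obtain ⟨x, hx0, hxn, hx⟩ := exists_nonneg_eigenvector G
  refine _root_.qIndex_lt_qIndex_movePendant huw hx ?_
  have hq9 : 9 ≤ qIndex G := le_trans (by exact_mod_cast hn) hq
  have hrow : ∀ v, qIndex G * x v = G.degree v * x v + ∑ j ∈ G.neighborFinset v, x j := by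
    intro v
    have := congrFun hx v
    rw [signlessLaplacian_mulVec, Pi.smul_apply, smul_eq_mul] at this
    exact this.symm
  obtain ⟨m, hm, hmax⟩ := Finset.exists_max_image (Finset.univ.erase u) x
    ⟨w, by simp [huw.symm]⟩
  replace hmax : ∀ v, v ≠ u → x v ≤ x m := fun v hv => hmax v (by simp [hv])
  have hmu : m ≠ u := Finset.ne_of_mem_erase hm
  have hM0 := hxn m
  have hX0 := hxn u
  have hsumle : ∀ (S : Finset V) (k : ℕ), u ∉ S → S.card ≤ k → ∑ j ∈ S, x j ≤ k * x m := by
    intro S k hS hk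
    calc ∑ j ∈ S, x j ≤ S.card • x m := Finset.sum_le_card_nsmul _ _ _ fun j hj =>
          hmax j (fun h => hS (h ▸ hj))
      _ = S.card * x m := nsmul_eq_mul _ _
      _ ≤ k * x m := mul_le_mul_of_nonneg_right (by exact_mod_cast hk) hM0
  have hNw : G.neighborFinset w ⊆ G.neighborFinset w ∩ G.neighborFinset u := by
    intro v hv
    rw [SimpleGraph.mem_neighborFinset] at hv
    have : v ≠ u := by rintro rfl; exact hnadj hv
    simp [hv, hu v this hv.ne']
  have hcw : (G.neighborFinset w).card ≤ 2 :=
    (Finset.card_le_card hNw).trans (hG.card_common_neighbors_le huw.symm)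
  -- The eigenvalue is at least 9 and `w` has degree at most 2, whence the coefficient 7.
  have hw7 : 7 * x w ≤ 2 * x m := by
    have h1 := hsumle (G.neighborFinset w) 2 (by simpa using hnadj) hcw
    have h2 := hrow w
    have h3 : (G.degree w : ℝ) ≤ 2 := by
      rw [← SimpleGraph.card_neighborFinset_eq_degree]; exact_mod_cast hcw
    push_cast at h1
    nlinarith [mul_nonneg (sub_nonneg.2 h3) (hxn w), mul_nonneg (sub_nonneg.2 hq9) (hxn w)]
  -- Such a `v` is adjacent to `u`, to at most two neighbours of `u`, and possibly to `w`: degree at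
  -- most 4, and 9 - 4 = 5.
  have hv5 : ∀ v, v ≠ u → v ≠ w → 5 * x v ≤ x u + 3 * x m := by
    intro v hvu hvw
    have hsub : (G.neighborFinset v).erase u ⊆
        insert w (G.neighborFinset v ∩ G.neighborFinset u) := by
      intro z hz
      simp only [Finset.mem_erase, SimpleGraph.mem_neighborFinset] at hz
      by_cases hzw : z = w
      · simp [hzw]
      · simp [hz.2, hu z hz.1 hzw]
    have hcard : ((G.neighborFinset v).erase u).card ≤ 3 :=
      (Finset.card_le_card hsub).trans ((Finset.card_insert_le _ _).trans
        (Nat.succ_le_succ (hG.card_common_neighbors_le hvu)))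
    have humem : u ∈ G.neighborFinset v := by simpa using (hu v hvu hvw).symm
    have h1 := hsumle ((G.neighborFinset v).erase u) 3 (by simp) hcard
    have h2 := hrow v
    rw [← Finset.add_sum_erase _ _ humem] at h2
    have h3 : (G.degree v : ℝ) ≤ 4 := by
      have := Finset.card_erase_add_one humem
      rw [SimpleGraph.card_neighborFinset_eq_degree] at this
      have h4 : G.degree v ≤ 4 := by omega
      exact_mod_cast h4
    push_cast at h1
    nlinarith [mul_nonneg (sub_nonneg.2 h3) (hxn v), mul_nonneg (sub_nonneg.2 hq9) (hxn v)]
  have hM : 2 * x m ≤ x u := by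
    by_cases hmw : m = w
    · rw [← hmw] at hw7; linarith
    · linarith [hv5 m hmu hmw]
  have hX : 0 < x u := by
    refine hX0.lt_of_ne fun h => hx0 (funext fun v => ?_)
    by_cases hv : v = u
    · rw [hv, ← h]; rfl
    · have := hmax v hv
      exact le_antisymm (by simp only [Pi.zero_apply]; linarith) (hxn v)
  have hterm : ∀ j ∈ G.neighborFinset w, (x w + x j) ^ 2 ≤ (x w + x u / 2) ^ 2 := by
    intro j hj
    have hju : j ≠ u := by
      rintro rfl; exact hnadj (by simpa using hj)
    have := hmax j hju
    exact pow_le_pow_left₀ (add_nonneg (hxn w) (hxn j)) (by linarith) 2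
  have hxw := hxn w
  calc ∑ j ∈ G.neighborFinset w, (x w + x j) ^ 2
      ≤ (G.neighborFinset w).card • (x w + x u / 2) ^ 2 := Finset.sum_le_card_nsmul _ _ _ hterm
    _ = (G.neighborFinset w).card * (x w + x u / 2) ^ 2 := nsmul_eq_mul _ _
    _ ≤ 2 * (x w + x u / 2) ^ 2 :=
        mul_le_mul_of_nonneg_right (by exact_mod_cast hcw) (sq_nonneg _)
    _ < (x w + x u) ^ 2 := by nlinarith

/-- If stars are `F`-free, and making the only vertex not adjacent to a vertex `u` pendant at `u`
preserves `F`-freeness, then the extremal graphs have a dominating vertex. -/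
theorem MaximizesQIndex.exists_dominating {W : Type*} {F : SimpleGraph W}
    (hn : 9 ≤ Fintype.card V)
    (hstar : ∀ (H : SimpleGraph V) (u : V), (∀ a b, H.Adj a b → a = u ∨ b = u) → F.Free H)
    (hmove : ∀ (H : SimpleGraph V) (u w : V), u ≠ w → (∀ v, v ≠ u → v ≠ w → H.Adj u v) →
      F.Free H → F.Free (movePendant H u w))
    (hG : MaximizesQIndex F G) : ∃ u, ∀ v, v ≠ u → G.Adj u v := by
  classical
  obtain ⟨⟨hconn, hfree, hout⟩, hmax⟩ := hG
  -- The competitor is the full star, admissible by `hstar`.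
  have hq : (Fintype.card V : ℝ) ≤ qIndex G := by
    obtain ⟨u⟩ := hconn.nonempty
    let H : SimpleGraph V :=
      { Adj := fun a b => a ≠ b ∧ (a = u ∨ b = u)
        symm := ⟨fun a b h => ⟨h.1.symm, h.2.symm⟩⟩
        loopless := ⟨fun a h => h.1 rfl⟩ }
    have hedge : ∀ a b, H.Adj a b → a = u ∨ b = u := fun a b h => h.2
    exact (card_le_qIndex_star H (u := u) (by omega) fun a b => Iff.rfl).trans
      (hmax H ⟨connected_of_forall_adj (u := u) fun v hv => ⟨hv.symm, Or.inl rfl⟩,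
        hstar H u hedge, isOuterplanar_of_edges_at_vertex hedge⟩)
  obtain ⟨u, hu⟩ : ∃ u, Fintype.card V < G.degree u + 3 := by
    by_contra! hdeg
    exact (hout.qIndex_lt_card hconn hn hdeg).not_ge hq
  refine ⟨u, ?_⟩
  by_contra! hw
  obtain ⟨w, hwu, hnadj⟩ := hw
  have huw : u ≠ w := hwu.symm
  have hall : ∀ v, v ≠ u → v ≠ w → G.Adj u v := by
    intro v hvu hvw
    by_contra hv
    have hsub : G.neighborFinset u ⊆ ((Finset.univ.erase u).erase w).erase v := by
      intro z hz
      rw [SimpleGraph.mem_neighborFinset] at hz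
      simp only [Finset.mem_erase, Finset.mem_univ, and_true]
      refine ⟨?_, ?_, hz.ne'⟩
      · rintro rfl; exact hv hz
      · rintro rfl; exact hnadj hz
    have h1 := Finset.card_le_card hsub
    rw [SimpleGraph.card_neighborFinset_eq_degree, Finset.card_erase_of_mem (by simp [hvu, hvw]),
      Finset.card_erase_of_mem (by simp [hwu]), Finset.card_erase_of_mem (by simp),
      Finset.card_univ] at h1
    omega
  have hlt := hout.qIndex_lt_qIndex_movePendant hn huw (fun h => hnadj h.symm) hall hq
  refine (hmax _ ⟨connected_of_forall_adj (u := u) fun v hv => ?_, hmove G u w huw hall hfree,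
    hout.movePendant huw hall⟩).not_gt hlt
  by_cases hvw : v = w
  · rw [hvw]; exact ((movePendant_adj_pendant huw).2 rfl).symm
  · exact (movePendant_adj_of_ne huw hvw).2 (hall v hv hvw)

theorem isContained_star_of_dominating {n : ℕ} (hV : Fintype.card V = n) {u : V}
    (hu : ∀ v, v ≠ u → G.Adj u v) :
    (completeBipartiteGraph (Fin 1) (Fin (n - 1))).IsContained G := by
  classical
  have hcard : Fintype.card {v : V // v ≠ u} = n - 1 := by
    rw [Fintype.card_subtype_compl, Fintype.card_subtype_eq, hV]
  let e : Fin (n - 1) ≃ {v : V // v ≠ u} := (Fintype.equivFinOfCardEq hcard).symm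
  refine ⟨⟨⟨Sum.elim (fun _ => u) (fun i => (e i : V)), ?_⟩, ?_⟩⟩
  · rintro (a | a) (b | b) h
    · simp at h
    · exact hu _ (e b).2
    · exact (hu _ (e a).2).symm
    · simp at h
  · rintro (a | a) (b | b) h
    · rw [Subsingleton.elim a b]
    · exact absurd h.symm (e b).2
    · exact absurd h (e a).2
    · exact congrArg Sum.inr (e.injective (Subtype.ext h))

end

end Extremal

/-! ### Unions of paths and cycles -/

theorem exists_adj_disjointCopies_pathGraph {t ℓ : ℕ} (hℓ : 2 ≤ ℓ) (p : Fin t × Fin ℓ) :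
    ∃ a, (disjointCopies t (SimpleGraph.pathGraph ℓ)).Adj p a := by
  obtain ⟨i, j⟩ := p
  rcases Nat.eq_zero_or_pos j.val with h | h
  · exact ⟨(i, ⟨1, by omega⟩), rfl, SimpleGraph.pathGraph_adj.2 (Or.inl (by simp [h]))⟩
  · exact ⟨(i, ⟨j - 1, by omega⟩), rfl, SimpleGraph.pathGraph_adj.2 (Or.inr (by simp; omega))⟩

theorem free_star_disjointCopies_pathGraph {V : Type*} {t ℓ : ℕ} (hℓ : 2 ≤ ℓ) (h5 : 5 ≤ t * ℓ)
    {H : SimpleGraph V} {u : V} (hH : ∀ a b, H.Adj a b → a = u ∨ b = u) :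
    (disjointCopies t (SimpleGraph.pathGraph ℓ)).Free H := by
  have ht : t ≠ 0 := by rintro rfl; simp at h5
  -- A single path has at least five vertices, so it contains two disjoint edges; otherwise two
  -- copies provide one each.
  by_cases ht1 : t = 1
  · subst ht1
    refine free_of_two_disjoint_edges hH (p := (0, ⟨0, by omega⟩)) (q := (0, ⟨1, by omega⟩))
      (r := (0, ⟨2, by omega⟩)) (s := (0, ⟨3, by omega⟩)) ⟨rfl, ?_⟩ ⟨rfl, ?_⟩ ?_ ?_ ?_ ?_ <;>
      simp [SimpleGraph.pathGraph_adj]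
  · refine free_of_two_disjoint_edges hH (p := (⟨0, by omega⟩, ⟨0, by omega⟩))
      (q := (⟨0, by omega⟩, ⟨1, by omega⟩)) (r := (⟨1, by omega⟩, ⟨0, by omega⟩))
      (s := (⟨1, by omega⟩, ⟨1, by omega⟩)) ⟨rfl, ?_⟩ ⟨rfl, ?_⟩ ?_ ?_ ?_ ?_ <;>
      simp [SimpleGraph.pathGraph_adj]

theorem exists_two_adj_cycleGraph {ℓ : ℕ} (hℓ : 4 ≤ ℓ) (p : Fin ℓ) :
    ∃ a b, a ≠ b ∧ (SimpleGraph.cycleGraph ℓ).Adj p a ∧ (SimpleGraph.cycleGraph ℓ).Adj p b := by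
  obtain ⟨m, rfl⟩ := Nat.exists_eq_add_of_le' hℓ
  refine ⟨p + 1, p - 1, ?_, ?_, ?_⟩
  · intro h
    -- The two cyclic neighbours could coincide only if 2 were 0 modulo the length.
    have h2 : (1 : Fin (m + 4)) + 1 = 0 := by
      have := congrArg (fun x => x - p + 1) h
      simpa using this
    have := congrArg Fin.val h2
    simp [Fin.val_add, Nat.mod_eq_of_lt (show 2 < m + 4 by omega)] at this
  · rw [SimpleGraph.cycleGraph_adj]; right; simp
  · rw [SimpleGraph.cycleGraph_adj]; left; simp

theorem free_star_cycleGraph {V : Type*} {ℓ : ℕ} (hℓ : 4 ≤ ℓ) {H : SimpleGraph V} {u : V}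
    (hH : ∀ a b, H.Adj a b → a = u ∨ b = u) : (SimpleGraph.cycleGraph ℓ).Free H := by
  refine free_of_two_disjoint_edges hH (p := ⟨0, by omega⟩) (q := ⟨1, by omega⟩)
    (r := ⟨2, by omega⟩) (s := ⟨3, by omega⟩)
    (SimpleGraph.pathGraph_le_cycleGraph (SimpleGraph.pathGraph_adj.2 (by simp)))
    (SimpleGraph.pathGraph_le_cycleGraph (SimpleGraph.pathGraph_adj.2 (by simp))) ?_ ?_ ?_ ?_ <;>
    simp

theorem theorem5 {V : Type*} [Fintype V] (n : ℕ) (hn : 9 ≤ n) (hV : Fintype.card V = n) :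
    (∀ t ℓ : ℕ, 1 ≤ t → 2 ≤ ℓ → 5 ≤ t * ℓ → t * ℓ ≤ n - 1 →
      ∀ G : SimpleGraph V, MaximizesQIndex (disjointCopies t (SimpleGraph.pathGraph ℓ)) G →
        (completeBipartiteGraph (Fin 1) (Fin (n - 1))).IsContained G) ∧
    (∀ ℓ : ℕ, 4 ≤ ℓ →
      ∀ G : SimpleGraph V, MaximizesQIndex (SimpleGraph.cycleGraph ℓ) G →
        (completeBipartiteGraph (Fin 1) (Fin (n - 1))).IsContained G) := by
  constructor
  · intro t ℓ _ hℓ h5 hle G hG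
    obtain ⟨u, hu⟩ := hG.exists_dominating (hV ▸ hn)
      (fun H u hH => free_star_disjointCopies_pathGraph hℓ h5 hH)
      (fun H u w huw hu hH => free_movePendant_of_card_lt huw hu
        (exists_adj_disjointCopies_pathGraph hℓ)
        (by rw [Fintype.card_prod, Fintype.card_fin, Fintype.card_fin, hV]; omega) hH)
    exact isContained_star_of_dominating hV hu
  · intro ℓ hℓ G hG
    obtain ⟨u, hu⟩ := hG.exists_dominating (hV ▸ hn)
      (fun H u hH => free_star_cycleGraph hℓ hH)
      (fun H u w huw _ hH => free_movePendant_of_two_neighbors huw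
        (exists_two_adj_cycleGraph hℓ) hH)
    exact isContained_star_of_dominating hV hu
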